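/- Let $\theta$ be an inner function, let $K_\theta = H^2\ominus\theta H^2\subset L^2(\mathbb T)$, and assume that $\dim K_\theta=\infty$ (equivalently, $\theta$ is not a finite Blaschke product). Let $P_\theta$ be the orthogonal projection of $L^2(\mathbb T)$ onto $K_\theta$. A bounded operator $A$ on $K_\theta$ is called a truncated Toeplitz operator if there is $\phi\in L^2(\mathbb T)$ with $Af=P_\theta(\phi f)$ for all $f\in K_\theta\cap L^\infty$. For $\lambda$ in the unit disk $\mathbb D$ put $$k_\lambda=\frac{1-\overline{\theta(\lambda)}\,\theta}{1-\bar\lambda z},\qquad \tilde k_\lambda=\frac{\theta-\theta(\lambda)}{z-\lambda},$$ and write $x\otimes y: h\mapsto (h,y)x$. For an integer $n\ge 0$ let $\Omega_n\subset\mathbb T$ be the set of points at which every $f\in K_\theta$ and its derivatives up to order $n$ have non-tangential limits. For $\lambda\in\mathbb D$ let $\mathrm D^n[\tilde k_\lambda\otimes k_\lambda]$ be the $n$-th derivative of $\lambda\mapsto\tilde k_\lambda\otimes k_\lambda$ with respect to $\lambda$, and let $\bar{\mathrm D}^n[k_\lambda\otimes\tilde k_\lambda]$ be the $n$-th derivative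 of $\lambda\mapsto k_\lambda\otimes\tilde k_\lambda$ with respect to $\bar\lambda$; for $\lambda\in\Omega_n$ let the same symbols denote the non-tangential limits at $\lambda$ of these operator-valued derivatives. Let $\mathbb D_e=\{z:|z|>1\}\cup\{\infty\}$, $\lambda^*=1/\bar\lambda$, $\infty^*=0$, and $$F(\lambda,n)=\begin{cases}\operatorname{Ran}\bar{\mathrm D}^n[k_\lambda\otimes\tilde k_\lambda], & \lambda\in\mathbb D\cup\Omega_n,\\ \operatorname{Ran}\mathrm D^n[\tilde k_{\lambda^*}\otimes k_{\lambda^*}], & \lambda\in\mathbb D_e.\end{cases}$$ Suppose that $A$ is a bounded truncated Toeplitz operator on $K_\theta$ whose range is a direct sum $$\operatorname{Ran}A=F(\lambda_1,n_1)\dotplus\cdots\dotplus F(\lambda_s,n_s),\qquad n_k\ge 0,\quad \lambda_k\in\mathbb D\cup\Omega_{n_k}\cup\mathbb D_e .$$ Then there are bounded truncated Toeplitz operators $A_1,\dots,A_s$ on $K_\theta$ such that $A=A_1+\cdots+A_s$ and $\operatorname{Ran}A_k=F(\lambda_k,n_k)$ for $k=1,\dots,s$. -/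

import Mathlib

open MeasureTheory Filter Topology
open scoped ComplexConjugate ENNReal

namespace TruncatedToeplitz

noncomputable section

/-- The unit circle, parametrized as `t ↦ exp (2 π i t)`. The coordinate function `z` is
`fourier 1`, and `fourier n` is `z ^ n`. -/
abbrev Torus : Type := UnitAddCircle

/-- Normalized Lebesgue measure on the unit circle. -/
abbrev leb : Measure Torus := AddCircle.haarAddCircle

/-- The space `L²` on the unit circle. -/
abbrev L2 : Type := Lp ℂ 2 leb

lemma fourierCoeff_eq_inner (f : L2) (n : ℤ) :
    fourierCoeff f n = inner ℂ (fourierLp 2 n : L2) f := by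
  rw [← fourierBasis_repr, fourierBasis.repr_apply_apply, coe_fourierBasis]

/-- The Hardy space `H²`, as a subspace of `L²` on the circle. -/
def hardy : Submodule ℂ L2 where
  carrier := {f | ∀ n : ℤ, n < 0 → fourierCoeff f n = 0}
  add_mem' {f g} hf hg n hn := by
    have h1 := hf n hn
    have h2 := hg n hn
    rw [fourierCoeff_eq_inner] at h1 h2 ⊢
    rw [inner_add_right, h1, h2, add_zero]
  zero_mem' n _ := by rw [fourierCoeff_eq_inner, inner_zero_right]
  smul_mem' c f hf n hn := by
    have h1 := hf n hn
    rw [fourierCoeff_eq_inner] at h1 ⊢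
    rw [inner_smul_right, h1, mul_zero]

/-- The value at the point `w` of the unit disk of (the holomorphic extension of) a function
of the Hardy space. -/
def diskValue (f : L2) (w : ℂ) : ℂ := ∑' n : ℕ, fourierCoeff f (n : ℤ) * w ^ n

/-- An inner function, given by its boundary values. -/
structure InnerFunction where
  /-- The boundary function. -/
  bdry : L2
  mem_hardy : bdry ∈ hardy
  norm_eq_one : ∀ᵐ t ∂leb, ‖bdry t‖ = 1

/-- The subspace `θ H²` of `L²`. -/
def InnerFunction.mulHardy (θ : InnerFunction) : Submodule ℂ L2 where
  carrier := {f | ∃ h ∈ hardy, f =ᵐ[leb] fun t => θ.bdry t * h t}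
  add_mem' := by
    rintro f g ⟨h, hh, hf⟩ ⟨k, hk, hg⟩
    refine ⟨h + k, hardy.add_mem hh hk, ?_⟩
    filter_upwards [hf, hg, Lp.coeFn_add f g, Lp.coeFn_add h k] with t h1 h2 h3 h4
    rw [h3, h4, Pi.add_apply, Pi.add_apply, h1, h2, mul_add]
  zero_mem' := by
    refine ⟨0, hardy.zero_mem, ?_⟩
    filter_upwards [Lp.coeFn_zero ℂ 2 leb] with t h1
    rw [h1, Pi.zero_apply, mul_zero]
  smul_mem' := by
    rintro c f ⟨h, hh, hf⟩
    refine ⟨c • h, hardy.smul_mem c hh, ?_⟩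
    filter_upwards [hf, Lp.coeFn_smul c f, Lp.coeFn_smul c h] with t h1 h2 h3
    rw [h2, h3, Pi.smul_apply, Pi.smul_apply, h1, smul_eq_mul, smul_eq_mul]
    ring

/-- The model space `K_θ = H² ⊖ θ H²`. -/
def modelSpace (θ : InnerFunction) : Submodule ℂ L2 := hardy ⊓ (θ.mulHardy)ᗮ

lemma isClosed_hardy : IsClosed (hardy : Set L2) := by
  have : (hardy : Set L2) =
      ⋂ (n : ℤ) (_ : n < 0), {f : L2 | inner ℂ (fourierLp 2 n : L2) f = 0} := by
    ext f
    simp only [Set.mem_iInter, Set.mem_ofPred_eq, ← fourierCoeff_eq_inner]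
    rfl
  rw [this]
  exact isClosed_iInter fun n => isClosed_iInter fun _ =>
    isClosed_eq (by fun_prop) continuous_const

lemma isClosed_modelSpace (θ : InnerFunction) : IsClosed (modelSpace θ : Set L2) :=
  isClosed_hardy.inter (Submodule.isClosed_orthogonal _)

instance (θ : InnerFunction) : CompleteSpace (modelSpace θ) :=
  (isClosed_modelSpace θ).completeSpace_coe

/-! ### Reproducing kernels -/

/-- The boundary function of the reproducing kernel at `w`,
`(1 - conj (θ w) θ) / (1 - conj w z)`. -/
def kernelFun (θ : InnerFunction) (w : ℂ) (t : Torus) : ℂ :=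
  (1 - conj (diskValue θ.bdry w) * θ.bdry t) / (1 - conj w * fourier 1 t)

/-- The boundary function of the conjugate kernel at `w`, `(θ - θ w) / (z - w)`. -/
def conjKernelFun (θ : InnerFunction) (w : ℂ) (t : Torus) : ℂ :=
  (θ.bdry t - diskValue θ.bdry w) / (fourier 1 t - w)

lemma norm_fourier_apply (n : ℤ) (t : Torus) : ‖fourier n t‖ = 1 := by
  rw [fourier_apply, Circle.norm_coe]

lemma den_ne_zero {w : ℂ} (hw : ‖w‖ < 1) (t : Torus) : 1 - conj w * fourier 1 t ≠ 0 := by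
  intro h
  have h1 : ‖conj w * fourier 1 t‖ = 1 := by rw [← sub_eq_zero.mp h, norm_one]
  rw [norm_mul, norm_fourier_apply, mul_one, RCLike.norm_conj] at h1
  exact hw.ne h1

lemma conjDen_ne_zero {w : ℂ} (hw : ‖w‖ < 1) (t : Torus) : (fourier 1 t : ℂ) - w ≠ 0 := by
  intro h
  have h1 := norm_fourier_apply 1 t
  rw [sub_eq_zero.mp h] at h1
  exact hw.ne h1

lemma continuous_memLp {g : Torus → ℂ} (hg : Continuous g) : MemLp g ∞ leb :=
  (BoundedContinuousFunction.mkOfCompact ⟨g, hg⟩).memLp_top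

lemma memLp_kernelFun (θ : InnerFunction) {w : ℂ} (hw : ‖w‖ < 1) :
    MemLp (kernelFun θ w) 2 leb := by
  have h1 : MemLp (fun t => (1 - conj w * fourier 1 t)⁻¹ : Torus → ℂ) ∞ leb :=
    continuous_memLp (Continuous.inv₀ (by fun_prop) (den_ne_zero hw))
  have h2 : MemLp (fun t => 1 - conj (diskValue θ.bdry w) * θ.bdry t : Torus → ℂ) 2 leb :=
    (memLp_const 1).sub ((Lp.memLp θ.bdry).const_mul _)
  exact h1.mul' h2

lemma memLp_conjKernelFun (θ : InnerFunction) {w : ℂ} (hw : ‖w‖ < 1) :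
    MemLp (conjKernelFun θ w) 2 leb := by
  have h1 : MemLp (fun t => ((fourier 1 t : ℂ) - w)⁻¹ : Torus → ℂ) ∞ leb :=
    continuous_memLp (Continuous.inv₀ (by fun_prop) (conjDen_ne_zero hw))
  have h2 : MemLp (fun t => θ.bdry t - diskValue θ.bdry w : Torus → ℂ) 2 leb :=
    (Lp.memLp θ.bdry).sub (memLp_const _)
  exact h1.mul' h2

lemma norm_fourierCoeff_le (g : Torus → ℂ) (n : ℤ) :
    ‖fourierCoeff g n‖ ≤ ∫ t, ‖g t‖ ∂leb := by
  refine (norm_integral_le_integral_norm _).trans_eq ?_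
  congr 1; ext t
  rw [norm_smul, norm_fourier_apply, one_mul]

lemma fourierCoeff_fourier_mul (g : Torus → ℂ) (n : ℤ) :
    fourierCoeff (fun t => fourier 1 t * g t) n = fourierCoeff g (n - 1) := by
  unfold fourierCoeff
  congr 1; ext t
  rw [smul_eq_mul, smul_eq_mul, ← mul_assoc, ← fourier_add]
  congr 3; ring

lemma integrable_fourier_mul {g : Torus → ℂ} (hg : Integrable g leb) :
    Integrable (fun t => fourier 1 t * g t) leb := hg.fourier_smul 1

lemma fourierCoeff_sub {f g : Torus → ℂ} (hf : Integrable f leb) (hg : Integrable g leb) (n : ℤ) :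
    fourierCoeff (fun t => f t - g t) n = fourierCoeff f n - fourierCoeff g n := by
  unfold fourierCoeff
  simp only [smul_sub]
  exact integral_sub (hf.fourier_smul _) (hg.fourier_smul _)

lemma fourierCoeff_const (c : ℂ) (n : ℤ) :
    fourierCoeff (fun _ => c : Torus → ℂ) n = if n = 0 then c else 0 := by
  have h := fourierCoeff.const_mul (fourier 0 : Torus → ℂ) c n
  rw [fourierCoeff_fourier] at h
  simp only [fourier_zero, mul_one] at h
  rw [h, Pi.single_apply]
  split_ifs <;> simp

lemma fourierCoeff_conj (g : Torus → ℂ) (n : ℤ) :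
    fourierCoeff (fun t => conj (g t)) n = conj (fourierCoeff g (-n)) := by
  unfold fourierCoeff
  rw [← integral_conj]
  congr 1; ext t
  simp [smul_eq_mul]

/-- Solving `u m - a u (m - 1) = v m` backwards for a bounded sequence `u`. -/
lemma hasSum_backward {u v : ℤ → ℂ} {a : ℂ} (ha : ‖a‖ < 1) {C : ℝ} (hu : ∀ n, ‖u n‖ ≤ C)
    (h : ∀ n, u n - a * u (n - 1) = v n) (m : ℤ) (hs : Summable fun k : ℕ => a ^ k * v (m - k)) :
    ∑' k : ℕ, a ^ k * v (m - k) = u m := by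
  have hpart : ∀ N : ℕ, ∑ k ∈ Finset.range N, a ^ k * v (m - k) = u m - a ^ N * u (m - N) := by
    intro N
    induction N with
    | zero => simp
    | succ N ih =>
      rw [Finset.sum_range_succ, ih, ← h]
      have : m - ((N + 1 : ℕ) : ℤ) = m - N - 1 := by push_cast; ring
      rw [this, pow_succ]; ring
  have hlim : Tendsto (fun N : ℕ => a ^ N * u (m - N)) atTop (𝓝 0) := by
    refine squeeze_zero_norm (a := fun N : ℕ => ‖a‖ ^ N * C) (fun N => ?_) ?_
    · rw [norm_mul, norm_pow]
      exact mul_le_mul_of_nonneg_left (hu _) (by positivity)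
    · simpa using (tendsto_pow_atTop_nhds_zero_of_lt_one (norm_nonneg a) ha).mul_const C
  refine tendsto_nhds_unique hs.hasSum.tendsto_sum_nat ?_
  simp only [hpart]
  simpa using tendsto_const_nhds.sub hlim

lemma summable_pow_mul {v : ℕ → ℂ} {a : ℂ} (ha : ‖a‖ < 1) {C : ℝ} (hv : ∀ n, ‖v n‖ ≤ C) :
    Summable fun k : ℕ => a ^ k * v k := by
  refine Summable.of_norm_bounded
    ((summable_geometric_of_lt_one (norm_nonneg a) ha).mul_right C) fun k => ?_
  rw [norm_mul, norm_pow]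
  exact mul_le_mul_of_nonneg_left (hv _) (by positivity)

/-- Fourier coefficients of `g` from those of `(1 - a z) g`. -/
lemma fourierCoeff_of_backward {g f : Torus → ℂ} (hg : Integrable g leb) {a : ℂ} (ha : ‖a‖ < 1)
    (h : ∀ᵐ t ∂leb, g t - a * (fourier 1 t * g t) = f t) (m : ℤ) :
    fourierCoeff g m = ∑' k : ℕ, a ^ k * fourierCoeff f (m - k) := by
  refine (hasSum_backward ha (norm_fourierCoeff_le g) (fun n => ?_) m
    (summable_pow_mul ha fun n => norm_fourierCoeff_le f _)).symm
  have h1 : fourierCoeff f n = fourierCoeff (fun t => g t - a * (fourier 1 t * g t)) n := by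
    unfold fourierCoeff
    refine integral_congr_ae ?_
    filter_upwards [h] with t ht
    rw [ht]
  rw [h1, fourierCoeff_sub hg ((integrable_fourier_mul hg).const_mul a),
    fourierCoeff.const_mul, fourierCoeff_fourier_mul]

/-- Fourier coefficients of `g` from those of `(z - a) g`. -/
lemma fourierCoeff_of_forward {g f : Torus → ℂ} (hg : Integrable g leb) {a : ℂ} (ha : ‖a‖ < 1)
    (h : ∀ᵐ t ∂leb, fourier 1 t * g t - a * g t = f t) (m : ℤ) :
    fourierCoeff g m = ∑' k : ℕ, a ^ k * fourierCoeff f (m + 1 + k) := by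
  have hrec : ∀ n : ℤ, fourierCoeff g (n - 1) - a * fourierCoeff g n = fourierCoeff f n := by
    intro n
    have h1 : fourierCoeff f n = fourierCoeff (fun t => fourier 1 t * g t - a * g t) n := by
      unfold fourierCoeff
      refine integral_congr_ae ?_
      filter_upwards [h] with t ht
      rw [ht]
    rw [h1, fourierCoeff_sub (integrable_fourier_mul hg) (hg.const_mul a),
      fourierCoeff.const_mul, fourierCoeff_fourier_mul]
  have := hasSum_backward (u := fun n => fourierCoeff g (-n))
    (v := fun n => fourierCoeff f (1 - n)) ha (fun n => norm_fourierCoeff_le g _)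
    (fun n => by
      have := hrec (1 - n)
      rw [show (1 - n - 1 : ℤ) = -n by ring] at this
      rw [← this, show (-(n - 1) : ℤ) = 1 - n by ring]) (-m)
    (summable_pow_mul ha fun n => norm_fourierCoeff_le f _)
  rw [neg_neg] at this
  rw [← this]
  congr 1; ext k
  congr 2; ring

lemma L2.integrable (f : L2) : Integrable f leb := (Lp.memLp f).integrable (by norm_num)

/-- A function `g` is orthogonal to `θ H²` as soon as `conj θ g` has no Fourier coefficients of
nonnegative order. -/
lemma mem_orthogonal_mulHardy (θ : InnerFunction) (g : L2)
    (hg : ∀ n : ℤ, 0 ≤ n → fourierCoeff (fun t => conj (θ.bdry t) * g t) n = 0) :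
    g ∈ (θ.mulHardy)ᗮ := by
  rw [Submodule.mem_orthogonal]
  rintro f ⟨h, hh, hf⟩
  have hθ : MemLp (fun t => conj (θ.bdry t) : Torus → ℂ) ∞ leb := by
    refine memLp_top_of_bound ?_ 1 ?_
    · exact continuous_star.comp_aestronglyMeasurable (Lp.aestronglyMeasurable θ.bdry)
    · filter_upwards [θ.norm_eq_one] with t ht
      rw [RCLike.norm_conj, ht]
  have hv : MemLp (fun t => conj (θ.bdry t) * g t) 2 leb := (Lp.memLp g).mul' hθ
  have h1 : inner ℂ f g = inner ℂ h (hv.toLp _ : L2) := by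
    rw [L2.inner_def, L2.inner_def]
    refine integral_congr_ae ?_
    filter_upwards [hf, hv.coeFn_toLp] with t h1 h2
    rw [h1, h2]
    simp only [RCLike.inner_apply', map_mul]
    ring
  rw [h1, ← (fourierBasis (T := 1)).tsum_inner_mul_inner]
  refine (tsum_congr fun n => ?_).trans tsum_zero
  rw [coe_fourierBasis, ← fourierCoeff_eq_inner]
  rcases lt_or_ge n 0 with hn | hn
  · have := hh n hn
    rw [fourierCoeff_eq_inner] at this
    rw [← inner_conj_symm, this]; simp
  · have h2 : fourierCoeff (hv.toLp _ : L2) n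
        = fourierCoeff (fun t => conj (θ.bdry t) * g t) n := by
      unfold fourierCoeff
      refine integral_congr_ae ?_
      filter_upwards [hv.coeFn_toLp] with t h2
      rw [h2]
    rw [h2, hg n hn, mul_zero]

lemma InnerFunction.conj_mul_self (θ : InnerFunction) :
    ∀ᵐ t ∂leb, conj (θ.bdry t) * θ.bdry t = 1 := by
  filter_upwards [θ.norm_eq_one] with t ht
  rw [mul_comm, Complex.mul_conj, Complex.normSq_eq_norm_sq, ht]; simp

lemma fourierCoeff_toLp_eq {g : Torus → ℂ} (hg : MemLp g 2 leb) (n : ℤ) :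
    fourierCoeff (hg.toLp g : L2) n = fourierCoeff g n := by
  unfold fourierCoeff
  refine integral_congr_ae ?_
  filter_upwards [hg.coeFn_toLp] with t h
  rw [h]

lemma integrable_conj (f : L2) : Integrable (fun t => conj (f t) : Torus → ℂ) leb := by
  refine (L2.integrable f).mono (continuous_star.comp_aestronglyMeasurable
    (Lp.aestronglyMeasurable f)) ?_
  filter_upwards with t
  rw [RCLike.norm_conj]

lemma InnerFunction.integrable_conj_mul (θ : InnerFunction) {g : Torus → ℂ}
    (hg : MemLp g 2 leb) : Integrable (fun t => conj (θ.bdry t) * g t) leb := by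
  refine (hg.integrable (by norm_num)).mono ((continuous_star.comp_aestronglyMeasurable
    (Lp.aestronglyMeasurable θ.bdry)).mul hg.aestronglyMeasurable) ?_
  filter_upwards [θ.norm_eq_one] with t ht
  rw [norm_mul, RCLike.norm_conj, ht, one_mul]

lemma fourierCoeff_congr {f g : Torus → ℂ} (h : f =ᵐ[leb] g) (n : ℤ) :
    fourierCoeff f n = fourierCoeff g n := by
  unfold fourierCoeff
  refine integral_congr_ae ?_
  filter_upwards [h] with t ht
  rw [ht]

lemma summable_diskValue (f : L2) {w : ℂ} (hw : ‖w‖ < 1) :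
    Summable fun k : ℕ => w ^ k * fourierCoeff f (k : ℤ) :=
  summable_pow_mul hw fun k => norm_fourierCoeff_le f k

lemma diskValue_eq (f : L2) (w : ℂ) :
    diskValue f w = ∑' k : ℕ, w ^ k * fourierCoeff f (k : ℤ) :=
  tsum_congr fun _ => mul_comm _ _

lemma tsum_sub_const {v : ℕ → ℂ} {a c : ℂ} (hv : Summable fun k => a ^ k * v k) :
    ∑' k : ℕ, a ^ k * (v k - if k = 0 then c else 0) = ∑' k : ℕ, a ^ k * v k - c := by
  have h : HasSum (fun k : ℕ => a ^ k * (if k = 0 then c else 0)) c := by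
    convert hasSum_ite_eq (0 : ℕ) c using 2 with k
    split_ifs with hk <;> simp [hk]
  simp only [mul_sub]
  exact (hv.hasSum.sub h).tsum_eq

/-- The kernel at a point of the disk belongs to the model space. -/
lemma kernel_mem (θ : InnerFunction) {w : ℂ} (hw : ‖w‖ < 1) :
    (memLp_kernelFun θ hw).toLp _ ∈ modelSpace θ := by
  have hw' : ‖conj w‖ < 1 := by rwa [RCLike.norm_conj]
  have hmem := memLp_kernelFun θ hw
  have hden : ∀ t, kernelFun θ w t - conj w * (fourier 1 t * kernelFun θ w t)
      = 1 - conj (diskValue θ.bdry w) * θ.bdry t := by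
    intro t
    have : (1 - conj w * fourier 1 t) * kernelFun θ w t
        = 1 - conj (diskValue θ.bdry w) * θ.bdry t := mul_div_cancel₀ _ (den_ne_zero hw t)
    linear_combination this
  refine ⟨fun n hn => ?_, mem_orthogonal_mulHardy θ _ fun n hn => ?_⟩
  · rw [fourierCoeff_toLp_eq, fourierCoeff_of_backward (hmem.integrable (by norm_num)) hw'
      (Eventually.of_forall hden)]
    refine (tsum_congr fun k => ?_).trans tsum_zero
    have hk : n - (k : ℤ) < 0 := by omega
    rw [fourierCoeff_sub (integrable_const _) ((L2.integrable θ.bdry).const_mul _),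
      fourierCoeff.const_mul, fourierCoeff_const, θ.mem_hardy _ hk, if_neg hk.ne]
    simp
  · have hae : (fun t => conj (θ.bdry t) * (hmem.toLp _ : L2) t) =ᵐ[leb]
        fun t => conj (θ.bdry t) * kernelFun θ w t := by
      filter_upwards [hmem.coeFn_toLp] with t ht
      rw [ht]
    have hae2 : ∀ᵐ t ∂leb, conj (θ.bdry t) * kernelFun θ w t
        - conj w * (fourier 1 t * (conj (θ.bdry t) * kernelFun θ w t))
        = conj (θ.bdry t) - conj (diskValue θ.bdry w) := by
      filter_upwards [θ.conj_mul_self] with t ht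
      linear_combination conj (θ.bdry t) * hden t - conj (diskValue θ.bdry w) * ht
    rw [fourierCoeff_congr hae, fourierCoeff_of_backward (θ.integrable_conj_mul hmem) hw' hae2]
    have hco : ∀ k : ℕ, fourierCoeff (fun t => conj (θ.bdry t) - conj (diskValue θ.bdry w))
        (n - k) = conj (fourierCoeff θ.bdry (k - n))
          - if n - (k : ℤ) = 0 then conj (diskValue θ.bdry w) else 0 := by
      intro k
      rw [fourierCoeff_sub (integrable_conj _) (integrable_const _), fourierCoeff_conj,
        fourierCoeff_const, neg_sub]
    simp only [hco]
    -- only the terms with `k ≥ n` survive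
    have hsum0 : ∑' k : ℕ, conj w ^ k * (conj (fourierCoeff θ.bdry k)
        - if k = 0 then conj (diskValue θ.bdry w) else 0) = 0 := by
      rw [tsum_sub_const (v := fun k : ℕ => conj (fourierCoeff θ.bdry k))
        (summable_pow_mul hw' fun k => by
          rw [RCLike.norm_conj]; exact norm_fourierCoeff_le θ.bdry k), diskValue_eq,
        Complex.conj_tsum]
      simp
    obtain ⟨N, rfl⟩ := Int.eq_ofNat_of_zero_le hn
    have hS : Summable fun k : ℕ => conj w ^ k * (conj (fourierCoeff θ.bdry (k - (N : ℤ)))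
          - if (N : ℤ) - (k : ℤ) = 0 then conj (diskValue θ.bdry w) else 0) := by
      simp only [← hco]
      exact summable_pow_mul hw' fun k => norm_fourierCoeff_le _ _
    rw [← hS.sum_add_tsum_nat_add N, Finset.sum_eq_zero, zero_add]
    · refine Eq.trans ?_ ((congrArg (conj w ^ N * ·) hsum0).trans (mul_zero _))
      simp only [← tsum_mul_left]
      refine tsum_congr fun k => ?_
      have h1 : ((k + N : ℕ) : ℤ) - N = k := by push_cast; ring
      have h2 : ((N : ℤ) - ((k + N : ℕ) : ℤ) = 0) ↔ k = 0 := by push_cast; omega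
      simp only [h1, h2, pow_add]
      ring
    · intro k hk
      rw [Finset.mem_range] at hk
      rw [θ.mem_hardy _ (by omega), if_neg (by omega)]
      simp

/-- The conjugate kernel at a point of the disk belongs to the model space. -/
lemma conjKernel_mem (θ : InnerFunction) {w : ℂ} (hw : ‖w‖ < 1) :
    (memLp_conjKernelFun θ hw).toLp _ ∈ modelSpace θ := by
  have hmem := memLp_conjKernelFun θ hw
  have hden : ∀ t, fourier 1 t * conjKernelFun θ w t - w * conjKernelFun θ w t
      = θ.bdry t - diskValue θ.bdry w := by
    intro t
    have : ((fourier 1 t : ℂ) - w) * conjKernelFun θ w t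
        = θ.bdry t - diskValue θ.bdry w := mul_div_cancel₀ _ (conjDen_ne_zero hw t)
    linear_combination this
  refine ⟨fun n hn => ?_, mem_orthogonal_mulHardy θ _ fun n hn => ?_⟩
  · rw [fourierCoeff_toLp_eq, fourierCoeff_of_forward (hmem.integrable (by norm_num)) hw
      (Eventually.of_forall hden)]
    have hco : ∀ k : ℕ, fourierCoeff (fun t => θ.bdry t - diskValue θ.bdry w)
        (n + 1 + k) = fourierCoeff θ.bdry (n + 1 + k)
          - if n + 1 + (k : ℤ) = 0 then diskValue θ.bdry w else 0 := by
      intro k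
      rw [fourierCoeff_sub (L2.integrable _) (integrable_const _), fourierCoeff_const]
    obtain ⟨N, hN⟩ := Int.eq_ofNat_of_zero_le (show 0 ≤ -(n + 1) by omega)
    obtain rfl : n = -(N : ℤ) - 1 := by omega
    have hS : Summable fun k : ℕ => w ^ k * (fourierCoeff θ.bdry (-(N : ℤ) - 1 + 1 + k)
          - if -(N : ℤ) - 1 + 1 + (k : ℤ) = 0 then diskValue θ.bdry w else 0) := by
      simp only [← hco]
      exact summable_pow_mul hw fun k => norm_fourierCoeff_le _ _
    simp only [hco]
    rw [← hS.sum_add_tsum_nat_add N, Finset.sum_eq_zero, zero_add]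
    · have hsum0 : ∑' k : ℕ, w ^ k * (fourierCoeff θ.bdry k
          - if k = 0 then diskValue θ.bdry w else 0) = 0 := by
        rw [tsum_sub_const (v := fun k : ℕ => fourierCoeff θ.bdry k)
          (summable_diskValue _ hw), diskValue_eq, sub_self]
      refine Eq.trans ?_ ((congrArg (w ^ N * ·) hsum0).trans (mul_zero _))
      simp only [← tsum_mul_left]
      refine tsum_congr fun k => ?_
      have h1 : -(N : ℤ) - 1 + 1 + ((k + N : ℕ) : ℤ) = k := by push_cast; ring
      simp only [h1, pow_add, Nat.cast_eq_zero]
      ring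
    · intro k hk
      rw [Finset.mem_range] at hk
      rw [θ.mem_hardy _ (by omega), if_neg (by omega)]
      simp
  · have hae : (fun t => conj (θ.bdry t) * (hmem.toLp _ : L2) t) =ᵐ[leb]
        fun t => conj (θ.bdry t) * conjKernelFun θ w t := by
      filter_upwards [hmem.coeFn_toLp] with t ht
      rw [ht]
    have hae2 : ∀ᵐ t ∂leb, fourier 1 t * (conj (θ.bdry t) * conjKernelFun θ w t)
        - w * (conj (θ.bdry t) * conjKernelFun θ w t)
        = 1 - diskValue θ.bdry w * conj (θ.bdry t) := by
      filter_upwards [θ.conj_mul_self] with t ht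
      linear_combination conj (θ.bdry t) * hden t + ht
    rw [fourierCoeff_congr hae, fourierCoeff_of_forward (θ.integrable_conj_mul hmem) hw hae2]
    refine (tsum_congr fun k => ?_).trans tsum_zero
    rw [fourierCoeff_sub (integrable_const _) ((integrable_conj _).const_mul _),
      fourierCoeff.const_mul, fourierCoeff_conj, fourierCoeff_const,
      θ.mem_hardy _ (by omega), if_neg (by omega)]
    simp

open scoped Classical in
/-- The reproducing kernel `k_w` of `K_θ` at a point `w` of the unit disk (and `0` elsewhere). -/
def kernel (θ : InnerFunction) (w : ℂ) : modelSpace θ :=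
  if hw : ‖w‖ < 1 then ⟨(memLp_kernelFun θ hw).toLp _, kernel_mem θ hw⟩ else 0

open scoped Classical in
/-- The conjugate kernel of `K_θ` at a point `w` of the unit disk (and `0` elsewhere). -/
def conjKernel (θ : InnerFunction) (w : ℂ) : modelSpace θ :=
  if hw : ‖w‖ < 1 then ⟨(memLp_conjKernelFun θ hw).toLp _, conjKernel_mem θ hw⟩ else 0

/-! ### Truncated Toeplitz operators -/

/-- The product of an `L²` function and an essentially bounded function, as an element of `L²`. -/
def mulBdd (φ f : L2) (hf : MemLp f ∞ leb) : L2 :=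
  (hf.mul' (Lp.memLp φ) : MemLp (fun t => φ t * f t) 2 leb).toLp _

/-- `A` is a bounded truncated Toeplitz operator on `K_θ`: there is a symbol `φ ∈ L²` such that
`A f = P_θ (φ f)` for all `f ∈ K_θ ∩ L^∞`. -/
def IsTruncatedToeplitz (θ : InnerFunction) (A : modelSpace θ →L[ℂ] modelSpace θ) : Prop :=
  ∃ φ : L2, ∀ (f : modelSpace θ) (hf : MemLp (f : L2) ∞ leb),
    A f = (modelSpace θ).orthogonalProjectionOnto (mulBdd φ (f : L2) hf)

/-! ### Nontangential limits -/

/-- The nontangential approach region of aperture `M` at the point `ζ` of the unit circle. -/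
def stolzAngle (M : ℝ) (ζ : ℂ) : Set ℂ := {w | ‖w‖ < 1 ∧ ‖ζ - w‖ < M * (1 - ‖w‖)}

/-- The filter of nontangential convergence to `ζ`: `Tendsto f (nontangential ζ) l` says that `f`
tends to `l` along every nontangential approach region at `ζ`. -/
def nontangential (ζ : ℂ) : Filter ℂ := ⨆ M : ℝ, 𝓝[stolzAngle M ζ] ζ

/-- The set `Ω_n` of the points of the unit circle at which all functions of `K_θ` and their
derivatives up to order `n` have (finite) nontangential limits. -/
def Omega (θ : InnerFunction) (n : ℕ) : Set ℂ :=
  {ζ | ‖ζ‖ = 1 ∧ ∀ f ∈ modelSpace θ, ∀ j ≤ n,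
    ∃ L : ℂ, Tendsto (iteratedDeriv j (diskValue f)) (nontangential ζ) (𝓝 L)}

/-! ### The elementary operators and their ranges -/

/-- Extension of an operator function on the disk to the points of the unit circle, by
nontangential limits in the weak operator topology. (At the points of interest the limit exists in
the operator norm as well, and the two limits are then the same operator.) -/
def boundaryExtend {θ : InnerFunction} (Ψ : ℂ → modelSpace θ →L[ℂ] modelSpace θ) (w : ℂ) :
    modelSpace θ →L[ℂ] modelSpace θ :=
  if ‖w‖ < 1 then Ψ w
  else (limUnder (nontangential w) fun μ => ContinuousLinearMapWOT.ofCLM (Ψ μ)).toCLM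

/-- The operator `D^n [k̃_w ⊗ k_w]`: the `n`-th derivative in `w` of the holomorphic function
`w ↦ k̃_w ⊗ k_w` for `w` in the disk, and the nontangential limit of that derivative
at `w ∈ Ω_n`. Here `x ⊗ y : h ↦ (h, y) x`. -/
def opD (θ : InnerFunction) (n : ℕ) (w : ℂ) : modelSpace θ →L[ℂ] modelSpace θ :=
  boundaryExtend
    (iteratedDeriv n fun μ => InnerProductSpace.rankOne ℂ (conjKernel θ μ) (kernel θ μ)) w

/-- The operator `D̄^n [k_w ⊗ k̃_w]`: the `n`-th derivative with respect to `conj w` of the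
antiholomorphic function `w ↦ k_w ⊗ k̃_w` for `w` in the disk, and the nontangential
limit of that derivative at `w ∈ Ω_n`. The derivative with respect to `conj w` is the complex
derivative at `conj w` of the holomorphic function obtained by precomposing with conjugation. -/
def opDbar (θ : InnerFunction) (n : ℕ) (w : ℂ) : modelSpace θ →L[ℂ] modelSpace θ :=
  boundaryExtend (fun μ => iteratedDeriv n
    (fun ν => InnerProductSpace.rankOne ℂ (kernel θ (conj ν)) (conjKernel θ (conj ν))) (conj μ)) w

/-- The set `𝔻 ∪ Ω_n ∪ 𝔻_e` in the Riemann sphere, where `𝔻_e = {|z| > 1} ∪ {∞}`. -/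
def admissible (θ : InnerFunction) (n : ℕ) : Set (OnePoint ℂ) :=
  (fun w : ℂ => (w : OnePoint ℂ)) '' ({w | ‖w‖ < 1} ∪ Omega θ n ∪ {w | 1 < ‖w‖}) ∪
    {OnePoint.infty}

/-- The subspace `F(w, n)`: the range of `D̄^n [k_w ⊗ k̃_w]` for `w ∈ 𝔻 ∪ Ω_n`, and the range of
`D^n [k̃_{w*} ⊗ k_{w*}]` for `w ∈ 𝔻_e`, where `w* = 1 / conj w` and `∞* = 0`. -/
def rangeSpace (θ : InnerFunction) (w : OnePoint ℂ) (n : ℕ) : Submodule ℂ (modelSpace θ) :=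
  match w with
  | OnePoint.infty => (opD θ n 0).range
  | OnePoint.some w => if ‖w‖ ≤ 1 then (opDbar θ n w).range else (opD θ n (1 / conj w)).range

end

end TruncatedToeplitz

/-! Let `T` be the backward shift of `K_θ` and `e` evaluation at the origin. Sarason's criterion
says that a bounded `A` is a truncated Toeplitz operator exactly when `(A f, g) = (A T f, T g)` for
all `f`, `g` in the kernel of `e`; on this kernel `T` is division by `z`. The two directions are
`IsTruncatedToeplitz.shiftInvariant` and `ShiftInvariant.isTruncatedToeplitz`.

Each space `F(λ, n)` is the span of a chain: the kernel at a point of the closed disk and its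
derivatives up to order `n`, or the images of such vectors under the conjugation `f ↦ θ * conj (z
f)` (`exists_kernelChain`). These spaces are finite-dimensional, so composing `A` with the
projections of its range splits it into bounded operators `B k` with the prescribed ranges
(`exists_decomposition`). It remains to see that each `B k` is shift invariant.

Fix `f` with `e f = 0`. On the kernel of `e`, the functional `g ↦ (g, B k f) - (T g, B k T f)` is a
combination of the functionals of the `k`-th chain, because the span of a chain is, up to `e`,
stable under the shift (`KernelChain.inner_mem_chainSpan`). The sum over `k` vanishes since `A` is
shift invariant. Chains at different points are linearly independent on the kernel of `e`
(`IsChain.coeff_eq_zero`), so every summand vanishes.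

The independence is the usual argument with products of `(z - w)` to suitable powers, written with
polynomials in `T`. The test function must vanish to high order at the origin, so that `T` really
divides by `z`, and still not be annihilated by the leading functional. Such functions exist because
`K_θ` is infinite-dimensional (`exists_mem_vanishing_ne_zero`). Directness of the sum makes the
points different: two chains of the same kind at the same point share their first vector. -/

namespace TruncatedToeplitz

noncomputable section

/-! ### Linear algebra of a backward shift -/

section Chains

open Polynomial

variable {V : Type*} [AddCommGroup V] [Module ℂ V] {T : Module.End ℂ V} {e : V →ₗ[ℂ] ℂ}

/-- The vectors whose first `N` coefficients `e f, e (T f), …` with respect to the backward shift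
`T` vanish. -/
def vanishing (T : Module.End ℂ V) (e : V →ₗ[ℂ] ℂ) (N : ℕ) : Submodule ℂ V where
  carrier := {f | ∀ i < N, e ((T ^ i) f) = 0}
  add_mem' {f g} hf hg i hi := by rw [map_add, map_add, hf i hi, hg i hi, add_zero]
  zero_mem' i _ := by rw [map_zero, map_zero]
  smul_mem' c f hf i hi := by rw [map_smul, map_smul, hf i hi, smul_zero]

lemma mem_vanishing {N : ℕ} {f : V} :
    f ∈ vanishing T e N ↔ ∀ i < N, e ((T ^ i) f) = 0 := Iff.rfl

lemma mem_vanishing_one {f : V} : f ∈ vanishing T e 1 ↔ e f = 0 := by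
  simp [mem_vanishing]

lemma vanishing_anti {M N : ℕ} (h : M ≤ N) : vanishing T e N ≤ vanishing T e M :=
  fun _ hf i hi => hf i (hi.trans_le h)

lemma eq_zero_of_mem_vanishing_succ {N : ℕ} {f : V} (hf : f ∈ vanishing T e (N + 1)) :
    e f = 0 := by simpa using hf 0 N.succ_pos

lemma pow_apply_mem_vanishing {N j : ℕ} {f : V} (hf : f ∈ vanishing T e (N + j)) :
    (T ^ j) f ∈ vanishing T e N := fun i hi => by
  rw [← Module.End.mul_apply, ← pow_add]
  exact hf _ (by omega)

lemma apply_mem_vanishing {N : ℕ} {f : V} (hf : f ∈ vanishing T e (N + 1)) :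
    T f ∈ vanishing T e N := by
  simpa using pow_apply_mem_vanishing (j := 1) hf

/-- Each application of `T` costs one order of vanishing, so a polynomial of degree `d` costs at
most `d`. All the orders chosen below follow from this count. -/
lemma aeval_apply_mem_vanishing {p : ℂ[X]} {d N : ℕ} (hp : p.natDegree ≤ d) {f : V}
    (hf : f ∈ vanishing T e (N + d)) : aeval T p f ∈ vanishing T e N := by
  rw [aeval_eq_sum_range' (Nat.lt_succ_of_le hp), LinearMap.sum_apply]
  refine Submodule.sum_mem _ fun i hi => Submodule.smul_mem _ _ ?_
  rw [Finset.mem_range] at hi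
  exact pow_apply_mem_vanishing (vanishing_anti (by omega) hf)

lemma aeval_mul_apply (p q : ℂ[X]) (f : V) :
    aeval T (p * q) f = aeval T p (aeval T q f) := by
  rw [map_mul, Module.End.mul_apply]

lemma aeval_apply_comm (p q : ℂ[X]) (f : V) :
    aeval T p (aeval T q f) = aeval T q (aeval T p f) := by
  rw [← aeval_mul_apply, mul_comm, aeval_mul_apply]

/-- A nonzero eigenfunctional of the backward shift does not vanish on any of the spaces
`vanishing T e N`, in infinite dimension. -/
lemma exists_mem_vanishing_ne_zero (hinj : ∀ f, (∀ i, e ((T ^ i) f) = 0) → f = 0)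
    (hinf : ¬ FiniteDimensional ℂ V) {l : V →ₗ[ℂ] ℂ} (hl : l ≠ 0) {c : ℂ}
    (hc : ∀ f, e f = 0 → l (T f) = c * l f) (N : ℕ) : ∃ w ∈ vanishing T e N, l w ≠ 0 := by
  induction N with
  | zero =>
    by_contra! h
    exact hl (LinearMap.ext fun f => h f fun i hi => absurd hi (Nat.not_lt_zero i))
  | succ N ih =>
    obtain ⟨g, hg, hlg⟩ := ih
    by_contra! h
    have hsucc : ∀ f ∈ vanishing T e N, e ((T ^ N) f) = 0 → f ∈ vanishing T e (N + 1) := by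
      intro f hf hfN i hi
      rcases Nat.lt_succ_iff_lt_or_eq.mp hi with hi | rfl
      · exact hf i hi
      · exact hfN
    have hgN : e ((T ^ N) g) ≠ 0 := fun h0 => hlg (h g (hsucc g hg h0))
    -- Inside `vanishing T e N`, the next space is the kernel of `e ∘ T ^ N`. As `l` vanishes there
    -- but not at `g`, it is a nonzero multiple of `e ∘ T ^ N`, and the two kernels agree.
    have hker : ∀ f ∈ vanishing T e N, l f = 0 → f ∈ vanishing T e (N + 1) := by
      intro f hf hlf
      refine hsucc f hf ?_
      have h1 := h (f - (e ((T ^ N) f) / e ((T ^ N) g)) • g) (hsucc _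
        (Submodule.sub_mem _ hf (Submodule.smul_mem _ _ hg)) (by
          rw [map_sub, map_sub, map_smul, map_smul, smul_eq_mul, div_mul_cancel₀ _ hgN, sub_self]))
      rw [map_sub, map_smul, hlf, zero_sub, neg_eq_zero, smul_eq_mul, mul_eq_zero] at h1
      exact (div_eq_zero_iff.mp (h1.resolve_right hlg)).resolve_right hgN
    have hT : ∀ f ∈ vanishing T e (N + 1), T f ∈ vanishing T e (N + 1) := fun f hf =>
      hker _ (apply_mem_vanishing hf)
        (by rw [hc f (eq_zero_of_mem_vanishing_succ hf), h f hf, mul_zero])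
    -- A `T`-invariant space contained in the kernel of `e` consists of vectors with no nonzero
    -- coefficient, hence is zero. Then the first `N + 1` coefficients determine a vector, against
    -- infinite dimension.
    have hbot : ∀ f ∈ vanishing T e (N + 1), f = 0 := by
      intro f hf
      refine hinj f fun i => eq_zero_of_mem_vanishing_succ (N := N) (T := T) ?_
      induction i with
      | zero => simpa using hf
      | succ i ih => rw [pow_succ', Module.End.mul_apply]; exact hT _ ih
    refine hinf (FiniteDimensional.of_injective
      (LinearMap.pi fun i : Fin (N + 1) => e ∘ₗ (T ^ (i : ℕ))) ?_)
    rw [← LinearMap.ker_eq_bot, LinearMap.ker_eq_bot']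
    exact fun f hf => hbot f fun i hi => congrFun hf ⟨i, hi⟩

/-- A chain of functionals `v 0, …, v n` on which the polynomial `p T` of the backward shift acts
as a derivation followed by `q T`. -/
structure IsChain (T : Module.End ℂ V) (e : V →ₗ[ℂ] ℂ) (n : ℕ) (v : ℕ → V →ₗ[ℂ] ℂ)
    (p q : ℂ[X]) : Prop where
  natDegree_le : p.natDegree ≤ 1
  natDegree_le' : q.natDegree ≤ 1
  apply_zero : ∀ f ∈ vanishing T e 2, v 0 (aeval T p f) = 0
  apply_succ : ∀ j < n, ∀ f ∈ vanishing T e 2,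
    v (j + 1) (aeval T p f) = (j + 1) * v j (aeval T q f)
  exists_ne_zero : ∀ N, ∃ w ∈ vanishing T e (N + 1), v 0 (aeval T (q ^ N) w) ≠ 0

namespace IsChain

variable {n : ℕ} {v : ℕ → V →ₗ[ℂ] ℂ} {p q : ℂ[X]}

lemma natDegree_pow_le_of_le_one {p : ℂ[X]} (hp : p.natDegree ≤ 1) (m : ℕ) :
    (p ^ m).natDegree ≤ m := by
  simpa using natDegree_pow_le_of_le m hp

/-- The analogue of the fact that the derivatives of order less than `m` of `(z - w) ^ m f` vanish
at `w`: each factor `p` lowers the index of the functional by one, and `v 0` is annihilated. -/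
lemma apply_pow_of_lt (h : IsChain T e n v p q) {m j : ℕ} (hj : j < m) (hjn : j ≤ n) {f : V}
    (hf : f ∈ vanishing T e (m + 1)) : v j (aeval T (p ^ m) f) = 0 := by
  induction m generalizing j f with
  | zero => exact absurd hj (Nat.not_lt_zero j)
  | succ m ih =>
    have hm : aeval T (p ^ m) f ∈ vanishing T e 2 := by
      refine aeval_apply_mem_vanishing (natDegree_pow_le_of_le_one h.natDegree_le m) ?_
      rwa [show 2 + m = m + 1 + 1 by ring]
    rw [pow_succ', aeval_mul_apply]
    cases j with
    | zero => exact h.apply_zero _ hm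
    | succ j =>
      rw [h.apply_succ j hjn _ hm, aeval_apply_comm, ih (by omega) (by omega), mul_zero]
      exact aeval_apply_mem_vanishing h.natDegree_le' hf

/-- The analogue of the `m`-th derivative of `(z - w) ^ m f` at `w`: the successive factors `m, m -
1, …, 1` come out. -/
lemma apply_pow_self (h : IsChain T e n v p q) {m : ℕ} (hm : m ≤ n) {f : V}
    (hf : f ∈ vanishing T e (m + 1)) :
    v m (aeval T (p ^ m) f) = (m.factorial : ℂ) * v 0 (aeval T (q ^ m) f) := by
  induction m generalizing f with
  | zero => simp
  | succ m ih =>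
    have hm' : aeval T (p ^ m) f ∈ vanishing T e 2 := by
      refine aeval_apply_mem_vanishing (natDegree_pow_le_of_le_one h.natDegree_le m) ?_
      rwa [show 2 + m = m + 1 + 1 by ring]
    rw [pow_succ', aeval_mul_apply, h.apply_succ m hm _ hm', aeval_apply_comm, ih (by omega),
      ← aeval_mul_apply, ← pow_succ, Nat.factorial_succ]
    · push_cast; ring
    · exact aeval_apply_mem_vanishing h.natDegree_le' hf

end IsChain

/-- The polynomial `P T` of the backward shift acts on the functional `v` as a nonzero multiple of
`q T ^ d`. -/
def ActsNonzero (T : Module.End ℂ V) (e : V →ₗ[ℂ] ℂ) (v : V →ₗ[ℂ] ℂ) (q : ℂ[X]) (d : ℕ)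
    (P : ℂ[X]) : Prop :=
  P.natDegree ≤ d ∧ ∃ c : ℂ, c ≠ 0 ∧ ∀ f ∈ vanishing T e (d + 1),
    v (aeval T P f) = c * v (aeval T (q ^ d) f)

lemma actsNonzero_one (v : V →ₗ[ℂ] ℂ) (q : ℂ[X]) : ActsNonzero T e v q 0 1 :=
  ⟨by simp, 1, one_ne_zero, fun f _ => by simp⟩

lemma ActsNonzero.mul {v : V →ₗ[ℂ] ℂ} {q P Q : ℂ[X]} (hq : q.natDegree ≤ 1) {a b : ℕ}
    (hP : ActsNonzero T e v q a P) (hQ : ActsNonzero T e v q b Q) :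
    ActsNonzero T e v q (a + b) (P * Q) := by
  obtain ⟨hPd, c, hc, hP⟩ := hP
  obtain ⟨hQd, c', hc', hQ⟩ := hQ
  refine ⟨natDegree_mul_le_of_le hPd hQd, c * c', mul_ne_zero hc hc', fun f hf => ?_⟩
  rw [aeval_mul_apply, hP, aeval_apply_comm, hQ, ← aeval_mul_apply, ← pow_add, add_comm b a,
    mul_assoc]
  · refine aeval_apply_mem_vanishing (IsChain.natDegree_pow_le_of_le_one hq a) ?_
    rwa [show b + 1 + a = a + b + 1 by ring]
  · refine aeval_apply_mem_vanishing hQd ?_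
    rwa [show a + 1 + b = a + b + 1 by ring]

lemma ActsNonzero.pow {v : V →ₗ[ℂ] ℂ} {q P : ℂ[X]} (hq : q.natDegree ≤ 1)
    (hP : ActsNonzero T e v q 1 P) (m : ℕ) : ActsNonzero T e v q m (P ^ m) := by
  induction m with
  | zero => simpa using actsNonzero_one v q
  | succ m ih => rw [pow_succ]; exact ih.mul hq hP

lemma ActsNonzero.prod {ι : Type*} {v : V →ₗ[ℂ] ℂ} {q : ℂ[X]} (hq : q.natDegree ≤ 1)
    (s : Finset ι) {P : ι → ℂ[X]} {d : ι → ℕ} (hP : ∀ i ∈ s, ActsNonzero T e v q (d i) (P i)) :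
    ActsNonzero T e v q (∑ i ∈ s, d i) (∏ i ∈ s, P i) := by
  classical
  induction s using Finset.induction_on with
  | empty => simpa using actsNonzero_one v q
  | insert i s his ih =>
    rw [Finset.sum_insert his, Finset.prod_insert his]
    exact (hP i (Finset.mem_insert_self i s)).mul hq
      (ih fun j hj => hP j (Finset.mem_insert_of_mem hj))

/-- Chains of functionals at different points are linearly independent on the kernel of `e`. -/
theorem IsChain.coeff_eq_zero {ι : Type*} [Fintype ι] [DecidableEq ι] {n : ι → ℕ}
    {v : ι → ℕ → V →ₗ[ℂ] ℂ} {p q : ι → ℂ[X]} (h : ∀ k, IsChain T e (n k) (v k) (p k) (q k))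
    (hcross : ∀ k l, l ≠ k → ActsNonzero T e (v k 0) (q k) 1 (p l)) {d : ι → ℕ → ℂ}
    (hd : ∀ g, e g = 0 → ∑ k, ∑ j ∈ Finset.range (n k + 1), d k j * v k j g = 0)
    (k : ι) {j : ℕ} (hj : j ≤ n k) : d k j = 0 := by
  by_contra hne
  -- The top index of a nonzero coefficient in the chain `k`. The test function `g = p k ^ m · P ·
  -- w` kills the lower indices of this chain by its first factor and the other chains by `P`.
  set m := Nat.findGreatest (fun i => d k i ≠ 0) (n k) with hm
  have hmn : m ≤ n k := Nat.findGreatest_le _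
  have hdm : d k m ≠ 0 := Nat.findGreatest_spec (P := fun i => d k i ≠ 0) hj hne
  have hgt : ∀ i, m < i → i ≤ n k → d k i = 0 := fun i hi hin =>
    not_not.mp (Nat.findGreatest_is_greatest hi hin)
  set P : ℂ[X] := ∏ l ∈ Finset.univ.erase k, p l ^ (n l + 1) with hP
  set D : ℕ := ∑ l ∈ Finset.univ.erase k, (n l + 1) with hD
  obtain ⟨hPdeg, c, hc, hPact⟩ : ActsNonzero T e (v k 0) (q k) D P :=
    ActsNonzero.prod (h k).natDegree_le' _ fun l hl =>
      (hcross k l (Finset.ne_of_mem_erase hl)).pow (h k).natDegree_le' _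
  -- The polynomial `p k ^ m * P` has degree at most `D + m`; the additional order of vanishing puts
  -- `g` in the kernel of `e`.
  obtain ⟨w, hw, hwne⟩ := (h k).exists_ne_zero (D + m)
  have hPw : aeval T P w ∈ vanishing T e (m + 1) :=
    aeval_apply_mem_vanishing hPdeg (by rwa [show m + 1 + D = D + m + 1 by ring])
  set g := aeval T (p k ^ m) (aeval T P w) with hg
  have hg0 : e g = 0 := mem_vanishing_one.mp (aeval_apply_mem_vanishing
    (natDegree_pow_le_of_le_one (h k).natDegree_le m) (by rwa [add_comm]))
  have hother : ∀ l, l ≠ k → ∀ i ≤ n l, v l i g = 0 := by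
    intro l hl i hi
    have hlmem : l ∈ Finset.univ.erase k := Finset.mem_erase.mpr ⟨hl, Finset.mem_univ l⟩
    -- The factor of `P` belonging to the chain `l` is applied last, where its power `n l + 1`
    -- exceeds every index of that chain.
    have hsplit : g = aeval T (p l ^ (n l + 1))
        (aeval T (p k ^ m * ∏ r ∈ (Finset.univ.erase k).erase l, p r ^ (n r + 1)) w) := by
      rw [hg, hP, ← Finset.mul_prod_erase _ _ hlmem]
      simp only [← aeval_mul_apply]
      congr 2; ring
    rw [hsplit]
    refine (h l).apply_pow_of_lt (Nat.lt_succ_of_le hi) hi ?_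
    refine aeval_apply_mem_vanishing (d := m + ∑ r ∈ (Finset.univ.erase k).erase l, (n r + 1))
      ?_ ?_
    · refine natDegree_mul_le_of_le (natDegree_pow_le_of_le_one (h k).natDegree_le m) ?_
      exact (natDegree_prod_le _ _).trans
        (Finset.sum_le_sum fun r _ => natDegree_pow_le_of_le_one (h r).natDegree_le _)
    · have := Finset.add_sum_erase _ (fun r => n r + 1) hlmem
      exact vanishing_anti (by omega) hw
  have hsum := hd g hg0
  rw [Finset.sum_eq_single k (fun l _ hl => Finset.sum_eq_zero fun i hi => by
    rw [hother l hl i (Nat.lt_succ_iff.mp (Finset.mem_range.mp hi)), mul_zero])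
    (fun hk => absurd (Finset.mem_univ k) hk),
    Finset.sum_eq_single m (fun i hi him => ?_)
      (fun hmem => absurd (Finset.mem_range.mpr (Nat.lt_succ_of_le hmn)) hmem),
    (h k).apply_pow_self hmn hPw, aeval_apply_comm, hPact, ← aeval_mul_apply, ← pow_add] at hsum
  · have hfac : (m.factorial : ℂ) ≠ 0 := Nat.cast_ne_zero.mpr m.factorial_ne_zero
    exact mul_ne_zero hdm (mul_ne_zero hfac (mul_ne_zero hc hwne)) hsum
  · exact aeval_apply_mem_vanishing (natDegree_pow_le_of_le_one (h k).natDegree_le' m)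
      (by rwa [show D + 1 + m = D + m + 1 by ring])
  · rw [Finset.mem_range, Nat.lt_succ_iff] at hi
    rcases lt_or_gt_of_ne him with hlt | hgt'
    · rw [(h k).apply_pow_of_lt hlt hi hPw, mul_zero]
    · rw [hgt i hgt' hi, zero_mul]

end Chains

end

end TruncatedToeplitz

namespace TruncatedToeplitz

noncomputable section

/-! ### Multiplication operators and Fourier coefficients -/

lemma L2.ext_fourierCoeff {f g : L2} (h : ∀ n, fourierCoeff f n = fourierCoeff g n) : f = g := by
  apply (fourierBasis (T := 1)).repr.injective
  ext n
  rw [fourierBasis_repr, fourierBasis_repr, h]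

lemma memLp_unimodular_mul {u : Torus → ℂ} (hu : AEStronglyMeasurable u leb)
    (h1 : ∀ᵐ t ∂leb, ‖u t‖ = 1) (f : L2) : MemLp (fun t => u t * f t) 2 leb := by
  refine (Lp.memLp f).mono (hu.mul (Lp.aestronglyMeasurable f)) ?_
  filter_upwards [h1] with t ht
  rw [norm_mul, ht, one_mul]

/-- Multiplication by a unimodular function. -/
def mulUnimodular (u : Torus → ℂ) (hu : AEStronglyMeasurable u leb)
    (h1 : ∀ᵐ t ∂leb, ‖u t‖ = 1) : L2 →L[ℂ] L2 :=
  LinearMap.mkContinuous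
    { toFun := fun f => (memLp_unimodular_mul hu h1 f).toLp _
      map_add' := fun f g => by
        rw [← MemLp.toLp_add]
        refine MemLp.toLp_congr _ _ ?_
        filter_upwards [Lp.coeFn_add f g] with t h
        rw [h, Pi.add_apply, Pi.add_apply, mul_add]
      map_smul' := fun c f => by
        rw [RingHom.id_apply, ← MemLp.toLp_const_smul]
        refine MemLp.toLp_congr _ _ ?_
        filter_upwards [Lp.coeFn_smul c f] with t h
        rw [h, Pi.smul_apply, Pi.smul_apply, smul_eq_mul, smul_eq_mul]
        ring } 1 fun f => by
    rw [one_mul]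
    refine Lp.norm_le_norm_of_ae_le ?_
    filter_upwards [h1, (memLp_unimodular_mul hu h1 f).coeFn_toLp] with t ht h
    change ‖(MemLp.toLp _ (memLp_unimodular_mul hu h1 f) : L2) t‖ ≤ _
    rw [h, norm_mul, ht, one_mul]

lemma coeFn_mulUnimodular {u : Torus → ℂ} (hu : AEStronglyMeasurable u leb)
    (h1 : ∀ᵐ t ∂leb, ‖u t‖ = 1) (f : L2) :
    mulUnimodular u hu h1 f =ᵐ[leb] fun t => u t * f t :=
  (memLp_unimodular_mul hu h1 f).coeFn_toLp

/-- Multiplication by `z ^ n`. -/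
def mulFourier (n : ℤ) : L2 →L[ℂ] L2 :=
  mulUnimodular (fourier n) (fourier n).continuous.aestronglyMeasurable
    (Eventually.of_forall (norm_fourier_apply n))

lemma coeFn_mulFourier (n : ℤ) (f : L2) : mulFourier n f =ᵐ[leb] fun t => fourier n t * f t :=
  coeFn_mulUnimodular _ _ f

lemma fourier_neg_one_mul (t : Torus) : (fourier (-1) t : ℂ) * fourier 1 t = 1 := by
  rw [← fourier_add]; simp

lemma conj_fourier_one (t : Torus) : conj (fourier 1 t : ℂ) = fourier (-1) t := by
  rw [fourier_neg]

lemma coeFn_fourierLp_zero : (fourierLp 2 0 : L2) =ᵐ[leb] fun _ => (1 : ℂ) := by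
  filter_upwards [coeFn_fourierLp (T := 1) 2 0] with t h
  rw [h, fourier_zero]

lemma fourierLp_mem_hardy (n : ℕ) : (fourierLp 2 (n : ℤ) : L2) ∈ hardy := by
  intro m hm
  rw [fourierCoeff_congr (coeFn_fourierLp (T := 1) 2 (n : ℤ)), fourierCoeff_fourier,
    Pi.single_apply, if_neg (by omega)]

lemma inner_eq_integral (f g : L2) : inner ℂ f g = ∫ t, conj (f t) * g t ∂leb := by
  rw [L2.inner_def]
  simp only [RCLike.inner_apply']

/-! ### The model space -/

variable (θ : InnerFunction)

lemma InnerFunction.aestronglyMeasurable : AEStronglyMeasurable θ.bdry leb :=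
  Lp.aestronglyMeasurable θ.bdry

/-- Orthogonality to `θ z ^ n` is the vanishing of the `n`-th Fourier coefficient of `conj θ * f`,
and membership becomes a condition on two Fourier spectra. -/
lemma mem_modelSpace_iff {f : L2} : f ∈ modelSpace θ ↔ f ∈ hardy ∧
    ∀ n : ℤ, 0 ≤ n → fourierCoeff (fun t => conj (θ.bdry t) * f t) n = 0 := by
  refine ⟨fun hf => ⟨hf.1, fun n hn => ?_⟩, fun hf => ⟨hf.1, mem_orthogonal_mulHardy θ f hf.2⟩⟩
  obtain ⟨N, rfl⟩ := Int.eq_ofNat_of_zero_le hn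
  have h1 := (Submodule.mem_orthogonal _ _).mp hf.2
    (mulUnimodular θ.bdry θ.aestronglyMeasurable θ.norm_eq_one (fourierLp 2 (N : ℤ)))
    ⟨_, fourierLp_mem_hardy N, coeFn_mulUnimodular _ _ _⟩
  rw [inner_eq_integral] at h1
  rw [← h1]
  refine integral_congr_ae ?_
  filter_upwards [coeFn_mulUnimodular θ.aestronglyMeasurable θ.norm_eq_one (fourierLp 2 (N : ℤ)),
    coeFn_fourierLp (T := 1) 2 (N : ℤ)] with t h2 h3
  rw [h2, h3, map_mul, smul_eq_mul, fourier_neg]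
  ring

/-- The backward shift of `L²`, `f ↦ (f - f̂(0)) / z`. -/
def backwardShiftL2 : L2 →L[ℂ] L2 :=
  (mulFourier (-1)).comp (ContinuousLinearMap.id ℂ L2 -
    (innerSL ℂ (fourierLp 2 0 : L2)).smulRight (fourierLp 2 0 : L2))

lemma coeFn_backwardShiftL2 (f : L2) : backwardShiftL2 f =ᵐ[leb]
    fun t => fourier (-1) t * (f t - fourierCoeff f 0) := by
  have h0 : backwardShiftL2 f =
      mulFourier (-1) (f - fourierCoeff f 0 • (fourierLp 2 0 : L2)) := by
    rw [fourierCoeff_eq_inner]; rfl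
  rw [h0]
  filter_upwards [coeFn_mulFourier (-1) (f - fourierCoeff f 0 • (fourierLp 2 0 : L2)),
    Lp.coeFn_sub f (fourierCoeff f 0 • (fourierLp 2 0 : L2)),
    Lp.coeFn_smul (fourierCoeff f 0) (fourierLp 2 0 : L2), coeFn_fourierLp_zero] with t h1 h2 h3 h4
  rw [h1, h2, Pi.sub_apply, h3, Pi.smul_apply, h4, smul_eq_mul, mul_one]

lemma fourierCoeff_backwardShiftL2 (f : L2) (n : ℤ) :
    fourierCoeff (backwardShiftL2 f) n =
      fourierCoeff f (n + 1) - if n + 1 = 0 then fourierCoeff f 0 else 0 := by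
  have h1 := fourierCoeff_fourier_mul (backwardShiftL2 f) (n + 1)
  rw [add_sub_cancel_right] at h1
  rw [← h1, ← fourierCoeff_const, ← fourierCoeff_sub (L2.integrable f) (integrable_const _)]
  refine fourierCoeff_congr ?_ _
  filter_upwards [coeFn_backwardShiftL2 f] with t h
  rw [h, ← mul_assoc, mul_comm (fourier 1 t : ℂ), fourier_neg_one_mul, one_mul]

/-- After multiplication by `z`, the function `conj θ * T f` becomes `conj θ * f` minus a multiple
of `conj θ`, and neither has positive frequencies. -/
lemma backwardShiftL2_mem {f : L2} (hf : f ∈ modelSpace θ) :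
    backwardShiftL2 f ∈ modelSpace θ := by
  rw [mem_modelSpace_iff] at hf ⊢
  refine ⟨fun n hn => ?_, fun n hn => ?_⟩
  · rw [fourierCoeff_backwardShiftL2]
    rcases eq_or_ne (n + 1) 0 with h | h
    · rw [if_pos h, h, sub_self]
    · rw [if_neg h, hf.1 _ (by omega), sub_zero]
  · have h1 := fourierCoeff_fourier_mul (fun t => conj (θ.bdry t) * backwardShiftL2 f t) (n + 1)
    rw [add_sub_cancel_right] at h1
    have h2 : (fun t => fourier 1 t * (conj (θ.bdry t) * backwardShiftL2 f t)) =ᵐ[leb]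
        fun t => conj (θ.bdry t) * f t - fourierCoeff f 0 * conj (θ.bdry t) := by
      filter_upwards [coeFn_backwardShiftL2 f] with t h
      rw [h]
      linear_combination conj (θ.bdry t) * (f t - fourierCoeff f 0) * fourier_neg_one_mul t
    rw [← h1, fourierCoeff_congr h2, fourierCoeff_sub (θ.integrable_conj_mul (Lp.memLp f))
      ((integrable_conj _).const_mul _), fourierCoeff.const_mul, fourierCoeff_conj,
      hf.2 _ (by omega), θ.mem_hardy _ (by omega)]
    simp

/-- The backward shift of the model space. -/
def backwardShift : modelSpace θ →L[ℂ] modelSpace θ :=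
  (backwardShiftL2.comp (modelSpace θ).subtypeL).codRestrict _
    fun f => backwardShiftL2_mem θ f.2

lemma coe_backwardShift (f : modelSpace θ) :
    (backwardShift θ f : L2) = backwardShiftL2 f := rfl

/-- Evaluation at the origin. -/
def evalZero : modelSpace θ →L[ℂ] ℂ :=
  (innerSL ℂ (fourierLp 2 0 : L2)).comp (modelSpace θ).subtypeL

lemma evalZero_apply (f : modelSpace θ) : evalZero θ f = fourierCoeff (f : L2) 0 := by
  rw [fourierCoeff_eq_inner]; rfl

lemma fourierCoeff_backwardShift (f : modelSpace θ) (n : ℕ) :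
    fourierCoeff (backwardShift θ f : L2) n = fourierCoeff (f : L2) ((n + 1 : ℕ) : ℤ) := by
  rw [coe_backwardShift, fourierCoeff_backwardShiftL2, if_neg (by omega), sub_zero]
  push_cast; rfl

lemma fourierCoeff_backwardShift_pow (f : modelSpace θ) (m n : ℕ) :
    fourierCoeff ((backwardShift θ ^ m) f : L2) n = fourierCoeff (f : L2) ((n + m : ℕ) : ℤ) := by
  induction m generalizing n with
  | zero => simp
  | succ m ih =>
    rw [pow_succ', mul_apply_eq_comp, fourierCoeff_backwardShift, ih]
    congr 2; ring

lemma evalZero_backwardShift_pow (f : modelSpace θ) (m : ℕ) :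
    evalZero θ ((backwardShift θ ^ m) f) = fourierCoeff (f : L2) (m : ℤ) := by
  rw [evalZero_apply]
  simpa using fourierCoeff_backwardShift_pow θ f m 0

lemma modelSpace_ext {f g : modelSpace θ}
    (h : ∀ n : ℕ, fourierCoeff (f : L2) n = fourierCoeff (g : L2) n) : f = g := by
  refine Subtype.ext (L2.ext_fourierCoeff fun n => ?_)
  rcases lt_or_ge n 0 with hn | hn
  · rw [f.2.1 n hn, g.2.1 n hn]
  · obtain ⟨N, rfl⟩ := Int.eq_ofNat_of_zero_le hn
    exact h N

lemma eq_zero_of_evalZero_pow {f : modelSpace θ}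
    (h : ∀ m : ℕ, evalZero θ ((backwardShift θ ^ m) f) = 0) : f = 0 := by
  refine modelSpace_ext θ fun n => ?_
  rw [← evalZero_backwardShift_pow, h, Submodule.coe_zero, fourierCoeff_eq_inner, inner_zero_right]

lemma hasSum_norm_sq_fourierCoeff {f : L2} (hf : f ∈ hardy) :
    HasSum (fun n : ℕ => ‖fourierCoeff f (n : ℤ)‖ ^ 2) (‖f‖ ^ 2) := by
  have h1 : HasSum (fun n : ℤ => ‖fourierCoeff f n‖ ^ 2) (‖f‖ ^ 2) := by
    have h2 := lp.hasSum_norm (p := 2) (by norm_num) ((fourierBasis (T := 1)).repr f)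
    rw [LinearIsometryEquiv.norm_map] at h2
    simpa [fourierBasis_repr] using h2
  refine (Function.Injective.hasSum_iff Nat.cast_injective fun n hn => ?_).mpr h1
  have hn0 : n < 0 := by
    by_contra h
    obtain ⟨N, rfl⟩ := Int.eq_ofNat_of_zero_le (not_lt.mp h)
    exact hn ⟨N, rfl⟩
  rw [hf n hn0]; simp

/-- The powers of the backward shift tend strongly to zero. -/
lemma tendsto_backwardShift_pow (f : modelSpace θ) :
    Tendsto (fun N => (backwardShift θ ^ N) f) atTop (𝓝 0) := by
  rw [tendsto_zero_iff_norm_tendsto_zero]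
  have h1 : ∀ N, ‖(backwardShift θ ^ N) f‖ ^ 2
      = ∑' n : ℕ, ‖fourierCoeff (f : L2) ((n + N : ℕ) : ℤ)‖ ^ 2 := by
    intro N
    have h2 := (hasSum_norm_sq_fourierCoeff ((backwardShift θ ^ N) f).2.1).tsum_eq
    simp only [fourierCoeff_backwardShift_pow] at h2
    exact h2.symm
  have h3 : Tendsto (fun N => ‖(backwardShift θ ^ N) f‖ ^ 2) atTop (𝓝 0) := by
    simp only [h1]
    exact tendsto_sum_nat_add fun n : ℕ => ‖fourierCoeff (f : L2) (n : ℤ)‖ ^ 2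
  simpa using h3.sqrt

/-! ### The conjugation -/

lemma memLp_conjugation (f : L2) :
    MemLp (fun t => θ.bdry t * conj (fourier 1 t * f t)) 2 leb := by
  refine (Lp.memLp f).mono (θ.aestronglyMeasurable.mul (continuous_star.comp_aestronglyMeasurable
    ((fourier 1).continuous.aestronglyMeasurable.mul (Lp.aestronglyMeasurable f)))) ?_
  filter_upwards [θ.norm_eq_one] with t ht
  rw [norm_mul, ht, one_mul, RCLike.norm_conj, norm_mul, norm_fourier_apply, one_mul]

/-- The conjugation `f ↦ θ * conj (z f)` of `L²`. -/
def conjugationL2 : L2 →L⋆[ℂ] L2 :=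
  LinearMap.mkContinuous
    { toFun := fun f => (memLp_conjugation θ f).toLp _
      map_add' := fun f g => by
        rw [← MemLp.toLp_add]
        refine MemLp.toLp_congr _ _ ?_
        filter_upwards [Lp.coeFn_add f g] with t h
        rw [h, Pi.add_apply, Pi.add_apply, mul_add, map_add, mul_add]
      map_smul' := fun c f => by
        rw [← MemLp.toLp_const_smul]
        refine MemLp.toLp_congr _ _ ?_
        filter_upwards [Lp.coeFn_smul c f] with t h
        rw [h, Pi.smul_apply, Pi.smul_apply, smul_eq_mul, smul_eq_mul, map_mul, map_mul, map_mul]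
        ring } 1 fun f => by
    rw [one_mul]
    refine Lp.norm_le_norm_of_ae_le ?_
    filter_upwards [θ.norm_eq_one, (memLp_conjugation θ f).coeFn_toLp] with t ht h
    change ‖(MemLp.toLp _ (memLp_conjugation θ f) : L2) t‖ ≤ _
    rw [h, norm_mul, ht, one_mul, RCLike.norm_conj, norm_mul, norm_fourier_apply, one_mul]

lemma coeFn_conjugationL2 (f : L2) :
    conjugationL2 θ f =ᵐ[leb] fun t => θ.bdry t * conj (fourier 1 t * f t) :=
  (memLp_conjugation θ f).coeFn_toLp

/-- The conjugation exchanges the two spectral conditions defining `K_θ`: `C f = conj (z * conj θ *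
f)` and `conj θ * C f = conj (z f)` almost everywhere. -/
lemma conjugationL2_mem {f : L2} (hf : f ∈ modelSpace θ) :
    conjugationL2 θ f ∈ modelSpace θ := by
  rw [mem_modelSpace_iff] at hf ⊢
  refine ⟨fun n hn => ?_, fun n hn => ?_⟩
  · have h1 : conjugationL2 θ f =ᵐ[leb]
        fun t => conj (fourier 1 t * (conj (θ.bdry t) * f t)) := by
      filter_upwards [coeFn_conjugationL2 θ f] with t h
      rw [h, map_mul, map_mul, map_mul, Complex.conj_conj]
      ring
    rw [fourierCoeff_congr h1,
      fourierCoeff_conj (fun t => fourier 1 t * (conj (θ.bdry t) * f t)),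
      fourierCoeff_fourier_mul (fun t => conj (θ.bdry t) * f t), hf.2 _ (by omega), map_zero]
  · have h1 : (fun t => conj (θ.bdry t) * conjugationL2 θ f t) =ᵐ[leb]
        fun t => conj (fourier 1 t * f t) := by
      filter_upwards [coeFn_conjugationL2 θ f, θ.conj_mul_self] with t h h'
      rw [h, ← mul_assoc, h', one_mul]
    rw [fourierCoeff_congr h1, fourierCoeff_conj (fun t => fourier 1 t * f t),
      fourierCoeff_fourier_mul, hf.1 _ (by omega), map_zero]

/-- The conjugation of the model space. -/
def conjugation : modelSpace θ →L⋆[ℂ] modelSpace θ :=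
  ((conjugationL2 θ).comp (modelSpace θ).subtypeL).codRestrict _
    fun f => conjugationL2_mem θ f.2

lemma coeFn_conjugation (f : modelSpace θ) :
    (conjugation θ f : L2) =ᵐ[leb] fun t => θ.bdry t * conj (fourier 1 t * (f : L2) t) :=
  coeFn_conjugationL2 θ f

lemma conj_fourier_mul_self (t : Torus) : conj (fourier 1 t : ℂ) * fourier 1 t = 1 := by
  rw [conj_fourier_one, fourier_neg_one_mul]

lemma conjugation_conjugation (f : modelSpace θ) : conjugation θ (conjugation θ f) = f := by
  refine Subtype.ext (Lp.ext ?_)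
  filter_upwards [coeFn_conjugation θ (conjugation θ f), coeFn_conjugation θ f,
    θ.conj_mul_self] with t h1 h2 h3
  rw [h1, h2]
  simp only [map_mul, Complex.conj_conj]
  linear_combination (f : L2) t * conj (θ.bdry t) * θ.bdry t * conj_fourier_mul_self t
    + (f : L2) t * h3

lemma inner_conjugation_conjugation (f g : modelSpace θ) :
    inner ℂ (conjugation θ f) (conjugation θ g) = inner ℂ g f := by
  rw [Submodule.coe_inner, Submodule.coe_inner, inner_eq_integral, inner_eq_integral]
  refine integral_congr_ae ?_
  filter_upwards [coeFn_conjugation θ f, coeFn_conjugation θ g, θ.conj_mul_self] with t h1 h2 h3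
  rw [h1, h2]
  simp only [map_mul, Complex.conj_conj]
  linear_combination conj ((g : L2) t) * (f : L2) t * conj (θ.bdry t) * θ.bdry t *
    conj_fourier_mul_self t + conj ((g : L2) t) * (f : L2) t * h3

lemma inner_conjugation_left (f g : modelSpace θ) :
    inner ℂ (conjugation θ f) g = inner ℂ (conjugation θ g) f := by
  rw [← inner_conjugation_conjugation, conjugation_conjugation]

lemma coeFn_backwardShift_of_evalZero {f : modelSpace θ} (hf : evalZero θ f = 0) :
    (backwardShift θ f : L2) =ᵐ[leb] fun t => fourier (-1) t * (f : L2) t := by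
  rw [evalZero_apply] at hf
  filter_upwards [coeFn_backwardShiftL2 f] with t h
  rw [coe_backwardShift, h, hf, sub_zero]

/-- When `f` vanishes at the origin, `T f = conj z * f`, and the conjugation turns division by `z`
into multiplication by `z`. -/
lemma coeFn_conjugation_backwardShift {f : modelSpace θ} (hf : evalZero θ f = 0) :
    (conjugation θ (backwardShift θ f) : L2) =ᵐ[leb]
      fun t => fourier 1 t * (conjugation θ f : L2) t := by
  filter_upwards [coeFn_conjugation θ (backwardShift θ f), coeFn_conjugation θ f,
    coeFn_backwardShift_of_evalZero θ hf] with t h1 h2 h3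
  rw [h1, h2, h3, ← conj_fourier_one]
  simp only [map_mul, Complex.conj_conj]
  ring

lemma evalZero_conjugation_backwardShift {f : modelSpace θ} (hf : evalZero θ f = 0) :
    evalZero θ (conjugation θ (backwardShift θ f)) = 0 := by
  rw [evalZero_apply, fourierCoeff_congr (coeFn_conjugation_backwardShift θ hf),
    fourierCoeff_fourier_mul]
  exact (conjugation θ f).2.1 _ (by norm_num)

lemma backwardShift_conjugation_backwardShift {f : modelSpace θ} (hf : evalZero θ f = 0) :
    backwardShift θ (conjugation θ (backwardShift θ f)) = conjugation θ f := by
  refine Subtype.ext (Lp.ext ?_)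
  filter_upwards [coeFn_backwardShift_of_evalZero θ (evalZero_conjugation_backwardShift θ hf),
    coeFn_conjugation_backwardShift θ hf] with t h1 h2
  rw [h1, h2, ← mul_assoc, fourier_neg_one_mul, one_mul]

end

end TruncatedToeplitz

namespace TruncatedToeplitz

noncomputable section

variable (θ : InnerFunction)

/-! ### The reproducing property -/

lemma integral_eq_fourierCoeff_zero (g : Torus → ℂ) : ∫ t, g t ∂leb = fourierCoeff g 0 := by
  unfold fourierCoeff
  simp

lemma coeFn_kernel {w : ℂ} (hw : ‖w‖ < 1) :
    (kernel θ w : L2) =ᵐ[leb] kernelFun θ w := by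
  rw [kernel, dif_pos hw]
  exact (memLp_kernelFun θ hw).coeFn_toLp

lemma coeFn_conjKernel {w : ℂ} (hw : ‖w‖ < 1) :
    (conjKernel θ w : L2) =ᵐ[leb] conjKernelFun θ w := by
  rw [conjKernel, dif_pos hw]
  exact (memLp_conjKernelFun θ hw).coeFn_toLp

lemma conjugation_kernel (w : ℂ) : conjugation θ (kernel θ w) = conjKernel θ w := by
  by_cases hw : ‖w‖ < 1
  · refine Subtype.ext (Lp.ext ?_)
    filter_upwards [coeFn_conjugation θ (kernel θ w), coeFn_kernel θ hw, coeFn_conjKernel θ hw,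
      θ.conj_mul_self] with t h1 h2 h3 h4
    have hd := den_ne_zero hw t
    have hd' := conjDen_ne_zero hw t
    have hz := conj_fourier_mul_self t
    have hd2 : 1 - w * conj (fourier 1 t : ℂ) ≠ 0 := by
      intro h
      apply hd
      have := congrArg conj h
      simpa using this
    rw [h1, h2, h3, kernelFun, conjKernelFun, map_mul, map_div₀]
    simp only [map_sub, map_one, map_mul, Complex.conj_conj]
    rw [← mul_div_assoc, ← mul_div_assoc, div_eq_div_iff hd2 hd']
    linear_combination (θ.bdry t - diskValue θ.bdry w) * hz
      - diskValue θ.bdry w * conj (fourier 1 t : ℂ) * (fourier 1 t - w) * h4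
  · rw [kernel, conjKernel, dif_neg hw, dif_neg hw, map_zero]

/-- This is `f = z T f + f(0)` evaluated at `w`, but obtained before the reproducing property is
known. Multiplying the conjugate kernel by `1 - w * conj z` leaves `1 - θ(w) * conj θ`; the term
with `conj θ * f` integrates to zero since `f ⊥ θ`, and the one with `conj (z k_w)` since `k_w ∈
H²`. -/
lemma inner_kernel {w : ℂ} (hw : ‖w‖ < 1) (f : modelSpace θ) :
    inner ℂ (kernel θ w) f = w * inner ℂ (kernel θ w) (backwardShift θ f) + evalZero θ f := by
  have hfθ := ((mem_modelSpace_iff θ).mp f.2).2 0 le_rfl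
  set c := fourierCoeff (f : L2) 0 with hc
  have hint1 : Integrable (fun t => conj ((kernel θ w : L2) t) * (f : L2) t) leb :=
    ((Lp.memLp (kernel θ w : L2)).star).integrable_mul (Lp.memLp (f : L2))
  have hint2 : Integrable
      (fun t => conj ((kernel θ w : L2) t) * (backwardShift θ f : L2) t) leb :=
    ((Lp.memLp (kernel θ w : L2)).star).integrable_mul (Lp.memLp (backwardShift θ f : L2))
  have hk : fourierCoeff (fun t => conj (fourier 1 t * (kernel θ w : L2) t)) 0 = 0 := by
    rw [fourierCoeff_conj (fun t => fourier 1 t * (kernel θ w : L2) t),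
      fourierCoeff_fourier_mul, (kernel θ w).2.1 _ (by norm_num), map_zero]
  have hkint : Integrable (fun t => conj (fourier 1 t * (kernel θ w : L2) t)) leb := by
    refine (integrable_fourier_mul (L2.integrable (kernel θ w : L2))).mono
      (continuous_star.comp_aestronglyMeasurable ((fourier 1).continuous.aestronglyMeasurable.mul
        (Lp.aestronglyMeasurable _))) (Eventually.of_forall fun t => ?_)
    rw [RCLike.norm_conj]
  have key : inner ℂ (kernel θ w) f - w * inner ℂ (kernel θ w) (backwardShift θ f) = c := by
    rw [Submodule.coe_inner, Submodule.coe_inner, inner_eq_integral, inner_eq_integral,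
      ← integral_const_mul, ← integral_sub hint1 (hint2.const_mul w)]
    have hae : (fun t => conj ((kernel θ w : L2) t) * (f : L2) t
        - w * (conj ((kernel θ w : L2) t) * (backwardShift θ f : L2) t)) =ᵐ[leb]
        fun t => ((f : L2) t - diskValue θ.bdry w * (conj (θ.bdry t) * (f : L2) t))
          - (-(w * c)) * conj (fourier 1 t * (kernel θ w : L2) t) := by
      filter_upwards [coeFn_kernel θ hw, coeFn_backwardShiftL2 (f : L2)] with t h1 h2
      have hden : (1 - w * fourier (-1) t) * conj (kernelFun θ w t)
          = 1 - diskValue θ.bdry w * conj (θ.bdry t) := by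
        have h3 : (1 - conj w * fourier 1 t) * kernelFun θ w t
            = 1 - conj (diskValue θ.bdry w) * θ.bdry t := mul_div_cancel₀ _ (den_ne_zero hw t)
        have h4 := congrArg conj h3
        simpa only [map_mul, map_sub, map_one, Complex.conj_conj, conj_fourier_one] using h4
      rw [coe_backwardShift, h2, h1, ← hc, map_mul, conj_fourier_one]
      linear_combination (f : L2) t * hden
    have hint3 : Integrable (fun t => (f : L2) t
        - diskValue θ.bdry w * (conj (θ.bdry t) * (f : L2) t)) leb :=
      (L2.integrable _).sub ((θ.integrable_conj_mul (Lp.memLp (f : L2))).const_mul _)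
    rw [integral_congr_ae hae, integral_eq_fourierCoeff_zero, fourierCoeff_sub hint3
      (hkint.const_mul _), fourierCoeff.const_mul, hk, fourierCoeff_sub (L2.integrable _)
      ((θ.integrable_conj_mul (Lp.memLp (f : L2))).const_mul _), fourierCoeff.const_mul, hfθ]
    simp [hc]
  rw [evalZero_apply, ← hc, ← key]
  ring

lemma inner_kernel_zero (f : modelSpace θ) : inner ℂ (kernel θ 0) f = evalZero θ f := by
  simpa using inner_kernel θ (w := 0) (by simp) f

lemma inner_kernel_eq_sum {w : ℂ} (hw : ‖w‖ < 1) (f : modelSpace θ) (N : ℕ) :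
    inner ℂ (kernel θ w) f = ∑ i ∈ Finset.range N, w ^ i * fourierCoeff (f : L2) (i : ℤ)
      + w ^ N * inner ℂ (kernel θ w) ((backwardShift θ ^ N) f) := by
  induction N with
  | zero => simp
  | succ N ih =>
    rw [ih, inner_kernel θ hw ((backwardShift θ ^ N) f), evalZero_backwardShift_pow,
      Finset.sum_range_succ, pow_succ' (backwardShift θ), mul_apply_eq_comp]
    ring

/-- The reproducing property. -/
lemma inner_kernel_eq_diskValue {w : ℂ} (hw : ‖w‖ < 1) (f : modelSpace θ) :
    inner ℂ (kernel θ w) f = diskValue (f : L2) w := by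
  rw [diskValue_eq]
  have h1 := (summable_diskValue (f : L2) hw).hasSum.tendsto_sum_nat
  have h2 : Tendsto (fun N => w ^ N * inner ℂ (kernel θ w) ((backwardShift θ ^ N) f))
      atTop (𝓝 0) := by
    -- Letting `N` tend to infinity in `inner_kernel_eq_sum`, the remainder vanishes because `T ^ N`
    -- tends strongly to zero.
    have h3 := (tendsto_const_nhds (x := kernel θ w)).inner (𝕜 := ℂ)
      (tendsto_backwardShift_pow θ f)
    simpa using (tendsto_pow_atTop_nhds_zero_of_norm_lt_one hw).mul h3
  have h4 := h1.add h2
  simp only [← inner_kernel_eq_sum θ hw f, add_zero] at h4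
  exact tendsto_nhds_unique tendsto_const_nhds h4

lemma norm_backwardShift_apply_le (f : modelSpace θ) : ‖backwardShift θ f‖ ≤ ‖f‖ := by
  have h1 := hasSum_norm_sq_fourierCoeff f.2.1
  have h2 := hasSum_norm_sq_fourierCoeff (backwardShift θ f).2.1
  simp only [fourierCoeff_backwardShift] at h2
  have h3 := (hasSum_nat_add_iff' 1).mpr h1
  have h4 := h2.unique h3
  refine le_of_sq_le_sq ?_ (norm_nonneg _)
  rw [Finset.sum_range_one] at h4
  change ‖((backwardShift θ f : modelSpace θ) : L2)‖ ^ 2 ≤ ‖(f : L2)‖ ^ 2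
  rw [h4]
  exact sub_le_self _ (by positivity)

lemma norm_backwardShift_le : ‖backwardShift θ‖ ≤ 1 :=
  ContinuousLinearMap.opNorm_le_bound _ zero_le_one fun f => by
    rw [one_mul]; exact norm_backwardShift_apply_le θ f

/-! ### Kernels as resolvents and holomorphy on the disk -/

section Resolvent

variable {H : Type*} [NormedAddCommGroup H] [InnerProductSpace ℂ H] [CompleteSpace H]
  {T : H →L[ℂ] H} {ν : ℂ}

lemma isUnit_one_sub_smul_adjoint_of_norm_le (hT : ‖T‖ ≤ 1) (hν : ‖ν‖ < 1) :
    IsUnit (1 - ν • ContinuousLinearMap.adjoint T) := by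
  refine isUnit_one_sub_of_norm_lt_one (R := H →L[ℂ] H) ?_
  rw [norm_smul, LinearIsometryEquiv.norm_map]
  exact (mul_le_of_le_one_right (norm_nonneg ν) hT).trans_lt hν

lemma differentiableAt_inverse_one_sub_smul_adjoint (hT : ‖T‖ ≤ 1) (x : H) (hν : ‖ν‖ < 1) :
    DifferentiableAt ℂ
      (fun ν : ℂ => Ring.inverse (1 - ν • ContinuousLinearMap.adjoint T) x) ν := by
  have h1 : DifferentiableAt ℂ (fun ν : ℂ => 1 - ν • ContinuousLinearMap.adjoint T) ν :=
    (differentiableAt_const _).sub (differentiableAt_id.smul_const _)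
  have h2 := (differentiableAt_inverse (𝕜 := ℂ)
    (isUnit_one_sub_smul_adjoint_of_norm_le hT hν)).comp ν h1
  exact h2.clm_apply (differentiableAt_const _)

end Resolvent

/-- The holomorphic function `ν ↦ k_{conj ν}`, as a resolvent of the compressed shift. -/
def kernelResolvent (ν : ℂ) : modelSpace θ :=
  Ring.inverse (1 - ν • ContinuousLinearMap.adjoint (backwardShift θ)) (kernel θ 0)

lemma isUnit_one_sub_smul_adjoint {ν : ℂ} (hν : ‖ν‖ < 1) :
    IsUnit (1 - ν • ContinuousLinearMap.adjoint (backwardShift θ)) :=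
  isUnit_one_sub_smul_adjoint_of_norm_le (norm_backwardShift_le θ) hν

/-- The identity `inner_kernel` says, by duality, that `1 - conj w • T*` sends `k_w` to `k_0`. This
makes the kernel a norm-holomorphic function of `conj w`. -/
lemma kernel_eq_kernelResolvent {w : ℂ} (hw : ‖w‖ < 1) :
    kernel θ w = kernelResolvent θ (conj w) := by
  have hw' : ‖conj w‖ < 1 := by rwa [RCLike.norm_conj]
  have h1 : (1 - conj w • ContinuousLinearMap.adjoint (backwardShift θ)) (kernel θ w)
      = kernel θ 0 := by
    refine ext_inner_right ℂ fun f => ?_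
    rw [inner_kernel_zero, sub_apply, smul_apply,
      inner_sub_left, inner_smul_left, ContinuousLinearMap.adjoint_inner_left, Complex.conj_conj]
    have := inner_kernel θ hw f
    rw [one_apply_eq_self]
    linear_combination this
  rw [kernelResolvent, ← h1, ← mul_apply_eq_comp,
    Ring.inverse_mul_cancel _ (isUnit_one_sub_smul_adjoint θ hw'), one_apply_eq_self]

lemma differentiableAt_kernelResolvent {ν : ℂ} (hν : ‖ν‖ < 1) :
    DifferentiableAt ℂ (kernelResolvent θ) ν :=
  differentiableAt_inverse_one_sub_smul_adjoint (norm_backwardShift_le θ) (kernel θ 0) hν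

lemma isOpen_disk : IsOpen {w : ℂ | ‖w‖ < 1} := isOpen_lt continuous_norm continuous_const

lemma disk_mem_nhds {w : ℂ} (hw : ‖w‖ < 1) : {w : ℂ | ‖w‖ < 1} ∈ 𝓝 w :=
  isOpen_disk.mem_nhds hw

lemma differentiableAt_diskValue (f : modelSpace θ) {w : ℂ} (hw : ‖w‖ < 1) :
    DifferentiableAt ℂ (diskValue (f : L2)) w := by
  have hw' : ‖conj w‖ < 1 := by rwa [RCLike.norm_conj]
  have h1 : DifferentiableAt ℂ (fun ν => inner ℂ f (kernelResolvent θ ν)) (conj w) :=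
    ((innerSL ℂ f).differentiableAt).comp _ (differentiableAt_kernelResolvent θ hw')
  have h2 := h1.conj_conj
  rw [Complex.conj_conj] at h2
  refine h2.congr_of_eventuallyEq ?_
  filter_upwards [disk_mem_nhds hw] with u hu
  simp only [Function.comp_apply]
  rw [← inner_kernel_eq_diskValue θ hu, kernel_eq_kernelResolvent θ hu]
  exact (inner_conj_symm (𝕜 := ℂ) (kernelResolvent θ (conj u)) f).symm

lemma diskValue_backwardShift (f : modelSpace θ) {w : ℂ} (hw : ‖w‖ < 1) :
    diskValue (f : L2) w = w * diskValue (backwardShift θ f : L2) w + evalZero θ f := by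
  rw [← inner_kernel_eq_diskValue θ hw, inner_kernel θ hw, inner_kernel_eq_diskValue θ hw]

lemma diskValue_zero (f : modelSpace θ) : diskValue (f : L2) 0 = evalZero θ f := by
  rw [← inner_kernel_eq_diskValue θ (by simp), inner_kernel_zero]

/-- If all values of `f` vanish, so do those of `T f = f / z`, at the origin by continuity.
Iterating, all Taylor coefficients vanish. -/
lemma eq_zero_of_diskValue {f : modelSpace θ} (h : ∀ w : ℂ, ‖w‖ < 1 → diskValue (f : L2) w = 0) :
    f = 0 := by
  have hstep : ∀ g : modelSpace θ, (∀ w : ℂ, ‖w‖ < 1 → diskValue (g : L2) w = 0) →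
      ∀ w : ℂ, ‖w‖ < 1 → diskValue (backwardShift θ g : L2) w = 0 := by
    intro g hg
    have h0 : evalZero θ g = 0 := by rw [← diskValue_zero]; exact hg 0 (by simp)
    have hne : ∀ w : ℂ, ‖w‖ < 1 → w ≠ 0 → diskValue (backwardShift θ g : L2) w = 0 := by
      intro w hw hw0
      have := diskValue_backwardShift θ g hw
      rw [hg w hw, h0, add_zero, eq_comm, mul_eq_zero] at this
      exact this.resolve_left hw0
    intro w hw
    rcases eq_or_ne w 0 with rfl | hw0
    · have hcont := (differentiableAt_diskValue θ (backwardShift θ g) hw).continuousAt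
      have h1 : Tendsto (diskValue (backwardShift θ g : L2)) (𝓝[≠] 0) (𝓝 0) := by
        refine tendsto_const_nhds.congr' ?_
        filter_upwards [self_mem_nhdsWithin, nhdsWithin_le_nhds (disk_mem_nhds hw)] with u hu hu1
        exact (hne u hu1 hu).symm
      exact tendsto_nhds_unique (hcont.tendsto.mono_left nhdsWithin_le_nhds) h1
    · exact hne w hw hw0
  refine eq_zero_of_evalZero_pow θ fun m => ?_
  rw [← diskValue_zero]
  suffices ∀ w : ℂ, ‖w‖ < 1 → diskValue ((backwardShift θ ^ m) f : L2) w = 0 from this 0 (by simp)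
  induction m with
  | zero => simpa using h
  | succ m ih => rw [pow_succ', mul_apply_eq_comp]; exact hstep _ ih

/-! ### Bounded functions of the model space -/

/-- The bounded functions of the model space. -/
def boundedFunctions : Submodule ℂ (modelSpace θ) where
  carrier := {f | MemLp (f : L2) ∞ leb}
  add_mem' {f g} hf hg := (hf.add hg).ae_eq (Lp.coeFn_add (f : L2) g).symm
  zero_mem' := (MemLp.zero (ε := ℂ)).ae_eq (Lp.coeFn_zero ℂ 2 leb).symm
  smul_mem' c f hf := (hf.const_smul c).ae_eq (Lp.coeFn_smul c (f : L2)).symm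

lemma mem_boundedFunctions {f : modelSpace θ} :
    f ∈ boundedFunctions θ ↔ MemLp (f : L2) ∞ leb := Iff.rfl

lemma InnerFunction.memLp_top : MemLp θ.bdry ∞ leb :=
  memLp_top_of_bound θ.aestronglyMeasurable 1 (θ.norm_eq_one.mono fun _ ht => ht.le)

lemma kernel_mem_boundedFunctions {w : ℂ} (hw : ‖w‖ < 1) : kernel θ w ∈ boundedFunctions θ := by
  have h1 : MemLp (fun t => (1 - conj w * fourier 1 t)⁻¹ : Torus → ℂ) ∞ leb :=
    continuous_memLp (Continuous.inv₀ (by fun_prop) (den_ne_zero hw))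
  have h2 : MemLp (fun t => 1 - conj (diskValue θ.bdry w) * θ.bdry t : Torus → ℂ) ∞ leb :=
    (memLp_const 1).sub (θ.memLp_top.const_mul _)
  exact (h1.mul' h2 : MemLp (kernelFun θ w) ∞ leb).ae_eq (coeFn_kernel θ hw).symm

/-- The kernels are bounded functions, and only zero is orthogonal to all of them. -/
lemma dense_boundedFunctions : Dense (boundedFunctions θ : Set (modelSpace θ)) := by
  rw [Submodule.dense_iff_topologicalClosure_eq_top, Submodule.topologicalClosure_eq_top_iff,
    Submodule.eq_bot_iff]
  intro f hf
  refine eq_zero_of_diskValue θ fun w hw => ?_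
  rw [← inner_kernel_eq_diskValue θ hw]
  exact (Submodule.mem_orthogonal _ _).mp hf _ (kernel_mem_boundedFunctions θ hw)

end

end TruncatedToeplitz

namespace TruncatedToeplitz

noncomputable section

variable (θ : InnerFunction)

lemma modelSpace_inner_smul_left (c : ℂ) (f g : modelSpace θ) :
    inner ℂ (c • f) g = conj c * inner ℂ f g := inner_smul_left f g c

lemma modelSpace_inner_smul_right (c : ℂ) (f g : modelSpace θ) :
    inner ℂ f (c • g) = c * inner ℂ f g := inner_smul_right f g c

lemma modelSpace_inner_conj_symm (f g : modelSpace θ) :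
    conj (inner ℂ f g) = inner ℂ g f := inner_conj_symm (𝕜 := ℂ) g f

/-! ### Shift invariance of truncated Toeplitz operators -/

/-- The form of `A` is invariant under the shift: `(A z f, z g) = (A f, g)` as soon as
`f, g, z f, z g` belong to the model space. -/
def ShiftInvariant (A : modelSpace θ →L[ℂ] modelSpace θ) : Prop :=
  ∀ f g : modelSpace θ, evalZero θ f = 0 → evalZero θ g = 0 →
    inner ℂ g (A f) = inner ℂ (backwardShift θ g) (A (backwardShift θ f))

lemma coeFn_mulBdd (φ f : L2) (hf : MemLp f ∞ leb) :
    mulBdd φ f hf =ᵐ[leb] fun t => φ t * f t := MemLp.coeFn_toLp _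

lemma inner_orthogonalProjectionOnto_mulBdd (φ : L2) (f g : modelSpace θ)
    (hf : MemLp (f : L2) ∞ leb) :
    inner ℂ g ((modelSpace θ).orthogonalProjectionOnto (mulBdd φ (f : L2) hf)) =
      ∫ t, conj ((g : L2) t) * (φ t * (f : L2) t) ∂leb := by
  rw [Submodule.inner_orthogonalProjectionOnto_eq_of_mem_left, inner_eq_integral]
  refine integral_congr_ae ?_
  filter_upwards [coeFn_mulBdd φ f hf] with t h
  rw [h]

lemma backwardShift_mem_boundedFunctions {f : modelSpace θ} (hf : f ∈ boundedFunctions θ)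
    (h0 : evalZero θ f = 0) : backwardShift θ f ∈ boundedFunctions θ :=
  (hf.mul' (continuous_memLp (fourier (-1)).continuous) :
    MemLp (fun t => fourier (-1) t * (f : L2) t) ∞ leb).ae_eq
      (coeFn_backwardShift_of_evalZero θ h0).symm

lemma exists_seq_boundedFunctions {f : modelSpace θ} (h0 : evalZero θ f = 0) :
    ∃ d : ℕ → modelSpace θ, (∀ n, d n ∈ boundedFunctions θ) ∧ (∀ n, evalZero θ (d n) = 0) ∧
      Tendsto d atTop (𝓝 f) := by
  obtain ⟨d, hd, hlim⟩ := mem_closure_iff_seq_limit.mp (dense_boundedFunctions θ f)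
  -- A multiple of `k_0` corrects the value at the origin. If `k_0 = 0`, then `e = 0`, so no
  -- correction is needed and the inverse of zero is harmless.
  refine ⟨fun n => d n - (evalZero θ (d n) * (evalZero θ (kernel θ 0))⁻¹) • kernel θ 0,
    fun n => Submodule.sub_mem _ (hd n)
      (Submodule.smul_mem _ _ (kernel_mem_boundedFunctions θ (by simp))), fun n => ?_, ?_⟩
  · rw [map_sub, map_smul, smul_eq_mul]
    rcases eq_or_ne (evalZero θ (kernel θ 0)) 0 with hk | hk
    · have h1 : kernel θ 0 = 0 := by
        rw [← inner_self_eq_zero (𝕜 := ℂ), inner_kernel_zero, hk]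
      rw [← inner_kernel_zero θ (d n), hk, h1, inner_zero_left]
      simp
    · rw [mul_assoc, inv_mul_cancel₀ hk, mul_one, sub_self]
  · have h1 : Tendsto (fun n => evalZero θ (d n)) atTop (𝓝 0) := by
      rw [← h0]
      exact ((evalZero θ).continuous.tendsto f).comp hlim
    have h2 := hlim.sub ((h1.mul_const (evalZero θ (kernel θ 0))⁻¹).smul_const (kernel θ 0))
    simpa using h2

variable {θ}

/-- For bounded `f` both sides are integrals against the symbol, in which the two factors `conj z`
and `z` cancel. Density of the bounded functions with `e f = 0` gives the general case. -/
theorem IsTruncatedToeplitz.shiftInvariant {A : modelSpace θ →L[ℂ] modelSpace θ}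
    (hA : IsTruncatedToeplitz θ A) : ShiftInvariant θ A := by
  obtain ⟨φ, hφ⟩ := hA
  intro f g hf hg
  obtain ⟨d, hd, hd0, hlim⟩ := exists_seq_boundedFunctions θ hf
  have hbdd : ∀ n, inner ℂ g (A (d n)) =
      inner ℂ (backwardShift θ g) (A (backwardShift θ (d n))) := by
    intro n
    rw [hφ _ ((mem_boundedFunctions θ).mp (hd n)), hφ _ ((mem_boundedFunctions θ).mp
      (backwardShift_mem_boundedFunctions θ (hd n) (hd0 n))),
      inner_orthogonalProjectionOnto_mulBdd, inner_orthogonalProjectionOnto_mulBdd]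
    refine integral_congr_ae ?_
    filter_upwards [coeFn_backwardShift_of_evalZero θ hg,
      coeFn_backwardShift_of_evalZero θ (hd0 n)] with t h1 h2
    rw [h1, h2, map_mul, ← conj_fourier_one, Complex.conj_conj]
    linear_combination -conj ((g : L2) t) * (φ t * (d n : L2) t) * conj_fourier_mul_self t
  have h1 : Tendsto (fun n => inner ℂ g (A (d n))) atTop (𝓝 (inner ℂ g (A f))) :=
    tendsto_const_nhds.inner ((A.continuous.tendsto f).comp hlim)
  have h2 : Tendsto (fun n => inner ℂ (backwardShift θ g) (A (backwardShift θ (d n)))) atTop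
      (𝓝 (inner ℂ (backwardShift θ g) (A (backwardShift θ f)))) :=
    tendsto_const_nhds.inner
      (((A.continuous.comp (backwardShift θ).continuous).tendsto f).comp hlim)
  simp only [hbdd] at h1
  exact tendsto_nhds_unique h1 h2

/-! ### From shift invariance to a symbol -/

variable (θ)

lemma mulFourier_one_mem_hardy {h : L2} (hh : h ∈ hardy) :
    mulFourier 1 h ∈ hardy := by
  intro n hn
  rw [fourierCoeff_congr (coeFn_mulFourier 1 h), fourierCoeff_fourier_mul]
  exact hh _ (by omega)

/-- Backward shift and multiplication by `z` are adjoint on `H²`: the constant removed from `g` is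
orthogonal to `z h`. -/
lemma inner_backwardShift_hardy (g : modelSpace θ) {h : L2} (hh : h ∈ hardy) :
    inner ℂ (backwardShift θ g : L2) h = inner ℂ (g : L2) (mulFourier 1 h) := by
  have h0 : fourierCoeff (mulFourier 1 h) 0 = 0 := by
    rw [fourierCoeff_congr (coeFn_mulFourier 1 h), fourierCoeff_fourier_mul]
    exact hh _ (by norm_num)
  have h1 : Integrable (fun t => conj ((g : L2) t) * mulFourier 1 h t) leb :=
    ((Lp.memLp (g : L2)).star).integrable_mul (Lp.memLp _)
  rw [← sub_zero (inner ℂ (g : L2) (mulFourier 1 h)),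
    ← mul_zero (conj (fourierCoeff (g : L2) 0)), ← h0,
    ← integral_eq_fourierCoeff_zero (mulFourier 1 h),
    inner_eq_integral, inner_eq_integral, ← integral_const_mul,
    ← integral_sub h1 ((L2.integrable _).const_mul _)]
  refine integral_congr_ae ?_
  filter_upwards [coeFn_backwardShiftL2 (g : L2), coeFn_mulFourier 1 h] with t h2 h3
  rw [coe_backwardShift, h2, h3, map_mul, map_sub, ← conj_fourier_one, Complex.conj_conj]
  ring

lemma inner_backwardShift_pow_hardy (g : modelSpace θ) {h : L2} (hh : h ∈ hardy) (n : ℕ) :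
    inner ℂ ((backwardShift θ ^ n) g : L2) h =
      ∫ t, conj ((g : L2) t) * (fourier n t * h t) ∂leb := by
  induction n generalizing h with
  | zero => simp [inner_eq_integral]
  | succ n ih =>
    rw [pow_succ', mul_apply_eq_comp, inner_backwardShift_hardy θ _ hh,
      ih (mulFourier_one_mem_hardy hh)]
    refine integral_congr_ae ?_
    filter_upwards [coeFn_mulFourier 1 h] with t h1
    rw [h1]
    push_cast
    rw [fourier_add]
    ring

lemma tendsto_fourier_partial_sum {f : L2} (hf : f ∈ hardy) :
    Tendsto (fun N : ℕ => ∑ n ∈ Finset.range N, fourierCoeff f (n : ℤ) • (fourierLp 2 (n : ℤ) : L2))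
      atTop (𝓝 f) := by
  refine HasSum.tendsto_sum_nat
    (f := fun n : ℕ => fourierCoeff f (n : ℤ) • (fourierLp 2 (n : ℤ) : L2)) ?_
  refine (Function.Injective.hasSum_iff (f := fun n : ℤ => fourierCoeff f n • (fourierLp 2 n : L2))
    Nat.cast_injective fun n hn => ?_).mpr (hasSum_fourier_series_L2 f)
  have hn0 : n < 0 := by
    by_contra h
    obtain ⟨N, rfl⟩ := Int.eq_ofNat_of_zero_le (not_lt.mp h)
    exact hn ⟨N, rfl⟩
  rw [hf n hn0, zero_smul]

/-- Since `g` is bounded, `conj g * h` is in `L²`. The partial sums are then its pairings with those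
of the Fourier series of `f`, which converge in `L²`. -/
lemma tendsto_sum_fourierCoeff_mul_inner {g : modelSpace θ} (hg : MemLp (g : L2) ∞ leb) {h f : L2}
    (hh : h ∈ hardy) (hf : f ∈ hardy) :
    Tendsto (fun N : ℕ => ∑ n ∈ Finset.range N,
        fourierCoeff f (n : ℤ) * inner ℂ ((backwardShift θ ^ n) g : L2) h) atTop
      (𝓝 (∫ t, conj ((g : L2) t) * h t * f t ∂leb)) := by
  have hu : MemLp (fun t => conj (conj ((g : L2) t) * h t)) 2 leb :=
    (((Lp.memLp h).mul' (hg.star : MemLp (star ((g : L2) : Torus → ℂ)) ∞ leb) :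
      MemLp (fun t => star ((g : L2) : Torus → ℂ) t * h t) 2 leb)).star
  have h1 : ∀ x : L2, inner ℂ (hu.toLp _ : L2) x = ∫ t, conj ((g : L2) t) * h t * x t ∂leb := by
    intro x
    rw [inner_eq_integral]
    refine integral_congr_ae ?_
    filter_upwards [hu.coeFn_toLp] with t ht
    rw [ht, Complex.conj_conj]
  have h2 : ∀ n : ℕ, inner ℂ ((backwardShift θ ^ n) g : L2) h =
      inner ℂ (hu.toLp _ : L2) (fourierLp 2 (n : ℤ) : L2) := by
    intro n
    rw [inner_backwardShift_pow_hardy θ g hh, h1]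
    refine integral_congr_ae ?_
    filter_upwards [coeFn_fourierLp (T := 1) 2 (n : ℤ)] with t ht
    rw [ht]; ring
  have h3 := (tendsto_const_nhds (x := (hu.toLp _ : L2))).inner (𝕜 := ℂ)
    (tendsto_fourier_partial_sum hf)
  rw [h1] at h3
  simpa only [inner_sum, inner_smul_right, ← h2] using h3

variable {θ}

lemma inner_eq_sum_add {A : modelSpace θ →L[ℂ] modelSpace θ} {ψ χ : modelSpace θ}
    (h : ∀ f g, inner ℂ g (A f) = inner ℂ (backwardShift θ g) (A (backwardShift θ f))
      + (evalZero θ f * inner ℂ g ψ + conj (evalZero θ g * inner ℂ f χ))) (f g : modelSpace θ)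
    (N : ℕ) :
    inner ℂ g (A f) = inner ℂ ((backwardShift θ ^ N) g) (A ((backwardShift θ ^ N) f))
      + ((∑ n ∈ Finset.range N,
          fourierCoeff (f : L2) (n : ℤ) * inner ℂ ((backwardShift θ ^ n) g) ψ)
        + conj (∑ n ∈ Finset.range N,
          fourierCoeff (g : L2) (n : ℤ) * inner ℂ ((backwardShift θ ^ n) f) χ)) := by
  induction N with
  | zero => simp
  | succ N ih =>
    rw [ih, h ((backwardShift θ ^ N) f), Finset.sum_range_succ, Finset.sum_range_succ,
      evalZero_backwardShift_pow, evalZero_backwardShift_pow, pow_succ', mul_apply_eq_comp,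
      mul_apply_eq_comp, map_add]
    ring

lemma memLp_add_conj (ψ χ : L2) : MemLp (fun t => ψ t + conj (χ t)) 2 leb :=
  (Lp.memLp ψ).add (Lp.memLp χ).star

/-- A bounded operator whose defect with respect to the backward shift has the right form is a
truncated Toeplitz operator. -/
lemma isTruncatedToeplitz_of_defect {A : modelSpace θ →L[ℂ] modelSpace θ} {ψ χ : modelSpace θ}
    (h : ∀ f g, inner ℂ g (A f) = inner ℂ (backwardShift θ g) (A (backwardShift θ f))
      + (evalZero θ f * inner ℂ g ψ + conj (evalZero θ g * inner ℂ f χ))) :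
    IsTruncatedToeplitz θ A := by
  -- The defect `A - T* A T` is `ψ ⊗ k_0 + k_0 ⊗ χ`. Telescoping it along the powers of `T` gives
  -- the form of the Toeplitz operator with symbol `ψ + conj χ`, as the remainder `(A T ^ N f, T ^ N
  -- g)` tends to zero.
  refine ⟨(memLp_add_conj (ψ : L2) χ).toLp _, fun f hf => ?_⟩
  rw [← sub_eq_zero]
  refine (dense_boundedFunctions θ).eq_zero_of_inner_right ℂ fun g hg => ?_
  rw [inner_sub_right, sub_eq_zero, inner_orthogonalProjectionOnto_mulBdd]
  have h0 : Tendsto (fun N => inner ℂ ((backwardShift θ ^ N) g) (A ((backwardShift θ ^ N) f)))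
      atTop (𝓝 0) := by
    have h1 := (tendsto_backwardShift_pow θ g).inner (𝕜 := ℂ)
      ((A.continuous.tendsto 0).comp (tendsto_backwardShift_pow θ f))
    simpa using h1
  have h1 := tendsto_sum_fourierCoeff_mul_inner θ hg ψ.2.1 f.2.1
  have h2 := tendsto_sum_fourierCoeff_mul_inner θ hf χ.2.1 g.2.1
  have h3 := h0.add (h1.add ((Complex.continuous_conj.tendsto _).comp h2))
  have h4 : inner ℂ g (A f) = 0 + (∫ t, conj ((g : L2) t) * (ψ : L2) t * (f : L2) t ∂leb
      + conj (∫ t, conj ((f : L2) t) * (χ : L2) t * (g : L2) t ∂leb)) := by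
    refine tendsto_nhds_unique (tendsto_const_nhds.congr fun N => ?_) h3
    exact inner_eq_sum_add h f g N
  have hint1 : Integrable (fun t => conj ((g : L2) t) * (ψ : L2) t * (f : L2) t) leb :=
    MemLp.integrable_mul (p := 2) (q := 2) ((Lp.memLp (ψ : L2)).mul'
      (hg.star : MemLp (star ((g : L2) : Torus → ℂ)) ∞ leb)) (Lp.memLp (f : L2))
  have hint2 : Integrable (fun t => (f : L2) t * conj ((χ : L2) t) * conj ((g : L2) t)) leb :=
    MemLp.integrable_mul (p := 2) (q := 2) ((Lp.memLp (χ : L2)).star.mul' hf)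
      (Lp.memLp (g : L2)).star
  rw [h4, zero_add, ← integral_conj]
  simp only [map_mul, Complex.conj_conj]
  rw [← integral_add hint1 hint2]
  refine integral_congr_ae ?_
  filter_upwards [(memLp_add_conj (ψ : L2) χ).coeFn_toLp] with t ht
  rw [ht]; ring

/-- Shift invariance says that the form of the defect `E = A - T* A T` vanishes on the kernel of
`e`. Splitting `f` and `g` along this hyperplane and the vector `b` shows that `E` has the rank-two
form required by `isTruncatedToeplitz_of_defect`. -/
theorem ShiftInvariant.isTruncatedToeplitz {A : modelSpace θ →L[ℂ] modelSpace θ}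
    (hA : ShiftInvariant θ A) {b : modelSpace θ} (hb : evalZero θ b = 1) :
    IsTruncatedToeplitz θ A := by
  set E : modelSpace θ →L[ℂ] modelSpace θ :=
    A - (ContinuousLinearMap.adjoint (backwardShift θ)).comp (A.comp (backwardShift θ)) with hE
  have hEinner : ∀ f g, inner ℂ g (E f) =
      inner ℂ g (A f) - inner ℂ (backwardShift θ g) (A (backwardShift θ f)) := by
    intro f g
    rw [hE, sub_apply, inner_sub_right, ContinuousLinearMap.comp_apply,
      ContinuousLinearMap.adjoint_inner_right, ContinuousLinearMap.comp_apply]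
  -- The multiple of `k_0` in `χ` compensates the component `(E b, b)`, which the terms from `E b`
  -- and `E* b` would count twice.
  refine isTruncatedToeplitz_of_defect (ψ := E b)
    (χ := ContinuousLinearMap.adjoint E b - conj (inner ℂ b (E b)) • kernel θ 0) fun f g => ?_
  have h1 : inner ℂ (g - evalZero θ g • b) (E (f - evalZero θ f • b)) = 0 := by
    rw [hEinner, sub_eq_zero]
    exact hA _ _ (by simp [hb]) (by simp [hb])
  have h2 : conj (inner ℂ f (ContinuousLinearMap.adjoint E b
      - conj (inner ℂ b (E b)) • kernel θ 0)) =
        inner ℂ b (E f) - inner ℂ b (E b) * evalZero θ f := by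
    rw [modelSpace_inner_conj_symm, inner_sub_left, ContinuousLinearMap.adjoint_inner_left,
      modelSpace_inner_smul_left,
      Complex.conj_conj, inner_kernel_zero]
  rw [map_mul, h2, ← sub_eq_iff_eq_add', ← hEinner]
  simp only [map_sub, map_smul, inner_sub_left, inner_sub_right,
    modelSpace_inner_smul_left, modelSpace_inner_smul_right] at h1
  linear_combination h1

end

end TruncatedToeplitz

namespace TruncatedToeplitz

noncomputable section

/-! ### Derivatives of vector and operator functions on the disk -/

section Derivatives

variable {H : Type*} [NormedAddCommGroup H] [InnerProductSpace ℂ H]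

lemma contDiffAt_of_differentiableAt_disk {E : Type*} [NormedAddCommGroup E] [NormedSpace ℂ E]
    [CompleteSpace E] {f : ℂ → E} (hf : ∀ w : ℂ, ‖w‖ < 1 → DifferentiableAt ℂ f w) (n : ℕ)
    {w : ℂ} (hw : ‖w‖ < 1) : ContDiffAt ℂ n f w := by
  have h1 : DifferentiableOn ℂ f {w | ‖w‖ < 1} := fun u hu => (hf u hu).differentiableWithinAt
  exact (h1.analyticAt (disk_mem_nhds hw)).contDiffAt

lemma iteratedDeriv_clm_comp {E F : Type*} [NormedAddCommGroup E] [NormedSpace ℂ E]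
    [NormedAddCommGroup F] [NormedSpace ℂ F] (L : E →L[ℂ] F) {f : ℂ → E} {n : ℕ} {w : ℂ}
    (hf : ContDiffAt ℂ n f w) :
    iteratedDeriv n (fun u => L (f u)) w = L (iteratedDeriv n f w) := by
  rw [iteratedDeriv_eq_iteratedFDeriv, iteratedDeriv_eq_iteratedFDeriv]
  have h := L.iteratedFDeriv_comp_left hf le_rfl
  change (iteratedFDeriv ℂ n (L ∘ f) w) _ = _
  rw [h]; rfl

lemma inner_iteratedDeriv [CompleteSpace H] {f : ℂ → H}
    (hf : ∀ w : ℂ, ‖w‖ < 1 → DifferentiableAt ℂ f w) (g : H) (n : ℕ) {w : ℂ} (hw : ‖w‖ < 1) :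
    inner ℂ g (iteratedDeriv n f w) = iteratedDeriv n (fun u => inner ℂ g (f u)) w :=
  (iteratedDeriv_clm_comp (innerSL ℂ g) (contDiffAt_of_differentiableAt_disk hf n hw)).symm

lemma inner_iteratedDeriv_apply [CompleteSpace H] {Ψ : ℂ → H →L[ℂ] H}
    (hΨ : ∀ w : ℂ, ‖w‖ < 1 → DifferentiableAt ℂ Ψ w) (g h : H) (n : ℕ) {w : ℂ} (hw : ‖w‖ < 1) :
    inner ℂ g (iteratedDeriv n Ψ w h) = iteratedDeriv n (fun u => inner ℂ g (Ψ u h)) w :=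
  (iteratedDeriv_clm_comp ((innerSL ℂ g).comp (ContinuousLinearMap.apply ℂ H h))
    (contDiffAt_of_differentiableAt_disk hΨ n hw)).symm

/-- The operator `x ⊗ y` is conjugate-linear in `y`, so inserting a conjugate-linear `C` makes the
dependence on `x` holomorphic in both slots. -/
lemma differentiableAt_rankOne [CompleteSpace H] (C : H →L⋆[ℂ] H) {x : ℂ → H} {w : ℂ}
    (hx : DifferentiableAt ℂ x w) :
    DifferentiableAt ℂ (fun u => InnerProductSpace.rankOne ℂ (x u) (C (x u))) w := by
  let J : H →L[ℂ] StrongDual ℂ H := (innerSL ℂ (E := H)).comp C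
  have h1 : DifferentiableAt ℂ (fun u => ContinuousLinearMap.smulRightL ℂ H H (J (x u))) w :=
    (ContinuousLinearMap.smulRightL ℂ H H).differentiableAt.comp w
      (J.differentiableAt.comp w hx)
  exact h1.clm_apply hx

lemma differentiableAt_conj_semilinear (C : H →L⋆[ℂ] H) {x : ℂ → H} {w : ℂ}
    (hx : DifferentiableAt ℂ x (conj w)) : DifferentiableAt ℂ (fun u => C (x (conj u))) w := by
  refine HasDerivAt.differentiableAt (f' := C (deriv x (conj w))) ?_
  have h1 := hasDerivAt_iff_isLittleO.mp hx.hasDerivAt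
  have h2 : Tendsto conj (𝓝 w) (𝓝 (conj w)) := Complex.continuous_conj.tendsto w
  have h3 := h1.comp_tendsto h2
  rw [hasDerivAt_iff_isLittleO]
  refine Asymptotics.IsBigO.trans_isLittleO (g := fun u =>
    x (conj u) - x (conj w) - (conj u - conj w) • deriv x (conj w)) ?_ ?_
  · refine Asymptotics.IsBigO.of_bound ‖C‖ (Eventually.of_forall fun u => ?_)
    have h4 : C (x (conj u)) - C (x (conj w)) - (u - w) • C (deriv x (conj w))
        = C (x (conj u) - x (conj w) - (conj u - conj w) • deriv x (conj w)) := by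
      rw [map_sub, map_sub, map_smulₛₗ, map_sub, Complex.conj_conj, Complex.conj_conj]
    rw [h4]
    exact C.le_opNorm _
  · refine h3.trans_isBigO (Asymptotics.IsBigO.of_bound 1 (Eventually.of_forall fun u => ?_))
    simp only [Function.comp_apply]
    rw [one_mul, ← map_sub, RCLike.norm_conj]

lemma iteratedDeriv_conj_conj (F : ℂ → ℂ) (n : ℕ) (w : ℂ) :
    iteratedDeriv n (fun u => conj (F (conj u))) (conj w) = conj (iteratedDeriv n F w) := by
  have h : ∀ n, iteratedDeriv n (conj ∘ F ∘ conj) = conj ∘ iteratedDeriv n F ∘ conj := by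
    intro n
    induction n with
    | zero => simp
    | succ n ih => rw [iteratedDeriv_succ, ih, deriv_conj_conj, iteratedDeriv_succ]
  have h1 := congrFun (h n) (conj w)
  simpa [Function.comp_def] using h1

/-- A pointwise convergent sequence of inner product functionals converges to an inner product
functional. -/
lemma exists_inner_of_tendsto [CompleteSpace H] {y : ℕ → H}
    (hy : ∀ f, ∃ L : ℂ, Tendsto (fun m => inner ℂ (y m) f) atTop (𝓝 L)) :
    ∃ κ : H, ∀ f, Tendsto (fun m => inner ℂ (y m) f) atTop (𝓝 (inner ℂ κ f)) := by
  choose L hL using hy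
  have h1 : Tendsto (fun m f => innerSL ℂ (y m) f) atTop (𝓝 L) := tendsto_pi_nhds.mpr hL
  -- The limit functional is bounded by the Banach–Steinhaus theorem and is represented by a vector
  -- by the Riesz theorem.
  refine ⟨(InnerProductSpace.toDual ℂ H).symm
    (continuousLinearMapOfTendsto (fun m => innerSL ℂ (y m)) h1), fun f => ?_⟩
  rw [InnerProductSpace.toDual_symm_apply]
  exact hL f

end Derivatives

/-! ### Jets of kernels -/

variable (θ : InnerFunction)

lemma norm_conj_lt_one {w : ℂ} (hw : ‖w‖ < 1) : ‖conj w‖ < 1 := by rwa [RCLike.norm_conj]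

/-- The derivatives of the reproducing kernel with respect to `conj w`. -/
def kernelDeriv (j : ℕ) (w : ℂ) : modelSpace θ := iteratedDeriv j (kernelResolvent θ) (conj w)

lemma inner_kernelDeriv (j : ℕ) {w : ℂ} (hw : ‖w‖ < 1) (f : modelSpace θ) :
    inner ℂ (kernelDeriv θ j w) f = iteratedDeriv j (diskValue (f : L2)) w := by
  rw [← modelSpace_inner_conj_symm, kernelDeriv, inner_iteratedDeriv
    (fun w hw => differentiableAt_kernelResolvent θ hw) f j (norm_conj_lt_one hw)]
  have h1 : (fun u => inner ℂ f (kernelResolvent θ u)) =ᶠ[𝓝 (conj w)]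
      fun u => conj (diskValue (f : L2) (conj u)) := by
    filter_upwards [disk_mem_nhds (norm_conj_lt_one hw)] with u hu
    rw [← inner_kernel_eq_diskValue θ (norm_conj_lt_one hu), modelSpace_inner_conj_symm,
      kernel_eq_kernelResolvent θ (norm_conj_lt_one hu), Complex.conj_conj]
  rw [h1.iteratedDeriv_eq, iteratedDeriv_conj_conj, Complex.conj_conj]

lemma contDiffAt_diskValue (f : modelSpace θ) (n : ℕ) {w : ℂ} (hw : ‖w‖ < 1) :
    ContDiffAt ℂ n (diskValue (f : L2)) w :=
  contDiffAt_of_differentiableAt_disk (fun _ hw => differentiableAt_diskValue θ f hw) n hw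

lemma differentiableAt_iteratedDeriv_diskValue (f : modelSpace θ) (n : ℕ) {w : ℂ}
    (hw : ‖w‖ < 1) : DifferentiableAt ℂ (iteratedDeriv n (diskValue (f : L2))) w := by
  have h1 : AnalyticOnNhd ℂ (diskValue (f : L2)) {w | ‖w‖ < 1} := by
    refine DifferentiableOn.analyticOnNhd (fun u hu => ?_) isOpen_disk
    exact (differentiableAt_diskValue θ f hu).differentiableWithinAt
  rw [iteratedDeriv_eq_iterate]
  exact (h1.iterated_deriv n w hw).differentiableAt

/-- Leibniz' rule for `f = z * T f + f(0)`. This recursion passes to boundary limits and is the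
source of all relations within a chain. -/
lemma iteratedDeriv_diskValue_succ (f : modelSpace θ) (j : ℕ) {w : ℂ} (hw : ‖w‖ < 1) :
    iteratedDeriv (j + 1) (diskValue (f : L2)) w =
      w * iteratedDeriv (j + 1) (diskValue (backwardShift θ f : L2)) w
        + (j + 1) * iteratedDeriv j (diskValue (backwardShift θ f : L2)) w := by
  induction j generalizing w with
  | zero =>
    have h1 : diskValue (f : L2) =ᶠ[𝓝 w]
        fun u => u * diskValue (backwardShift θ f : L2) u + evalZero θ f := by
      filter_upwards [disk_mem_nhds hw] with u hu
      exact diskValue_backwardShift θ f hu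
    have h2 := (differentiableAt_diskValue θ (backwardShift θ f) hw).hasDerivAt
    have h3 := ((hasDerivAt_id w).mul h2).add_const (evalZero θ f)
    rw [zero_add, iteratedDeriv_one, h1.deriv_eq, iteratedDeriv_one, iteratedDeriv_zero]
    refine (HasDerivAt.deriv h3).trans ?_
    simp only [id_eq]
    push_cast; ring
  | succ j ih =>
    have h1 : iteratedDeriv (j + 1) (diskValue (f : L2)) =ᶠ[𝓝 w]
        fun u => u * iteratedDeriv (j + 1) (diskValue (backwardShift θ f : L2)) u
          + (j + 1) * iteratedDeriv j (diskValue (backwardShift θ f : L2)) u := by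
      filter_upwards [disk_mem_nhds hw] with u hu
      exact ih hu
    have h2 := (differentiableAt_iteratedDeriv_diskValue θ (backwardShift θ f) (j + 1)
      hw).hasDerivAt
    have h3 := (differentiableAt_iteratedDeriv_diskValue θ (backwardShift θ f) j hw).hasDerivAt
    have h4 := ((hasDerivAt_id w).mul h2).add (h3.const_mul ((j : ℂ) + 1))
    rw [iteratedDeriv_succ (n := j + 1), h1.deriv_eq]
    refine (HasDerivAt.deriv h4).trans ?_
    rw [← iteratedDeriv_succ, ← iteratedDeriv_succ]
    simp only [id_eq]
    push_cast; ring

/-- The vectors `κ 0, …, κ n` represent the values at `w` of the derivatives of order at most `n`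
of the functions of the model space, the values being taken along the filter `l`. -/
structure RepresentsJet (n : ℕ) (w : ℂ) (l : Filter ℂ) (κ : ℕ → modelSpace θ) : Prop where
  le_nhds : l ≤ 𝓝 w
  eventually_disk : ∀ᶠ u in l, ‖u‖ < 1
  tendsto : ∀ j ≤ n, ∀ f : modelSpace θ,
    Tendsto (iteratedDeriv j (diskValue (f : L2))) l (𝓝 (inner ℂ (κ j) f))

variable {θ}

namespace RepresentsJet

variable {n : ℕ} {w : ℂ} {l : Filter ℂ} {κ : ℕ → modelSpace θ}

lemma inner_zero [l.NeBot] (h : RepresentsJet θ n w l κ) (f : modelSpace θ) :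
    inner ℂ (κ 0) f = w * inner ℂ (κ 0) (backwardShift θ f) + evalZero θ f := by
  have h1 := h.tendsto 0 n.zero_le f
  have h2 := h.tendsto 0 n.zero_le (backwardShift θ f)
  rw [iteratedDeriv_zero] at h1 h2
  have h0 : Tendsto (fun u : ℂ => u) l (𝓝 w) := h.le_nhds
  refine tendsto_nhds_unique (h1.congr' ?_) ((h0.mul h2).add_const (evalZero θ f))
  filter_upwards [h.eventually_disk] with u hu
  exact diskValue_backwardShift θ f hu

lemma inner_succ [l.NeBot] (h : RepresentsJet θ n w l κ) {j : ℕ} (hj : j < n) (f : modelSpace θ) :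
    inner ℂ (κ (j + 1)) f = w * inner ℂ (κ (j + 1)) (backwardShift θ f)
      + (j + 1) * inner ℂ (κ j) (backwardShift θ f) := by
  have h1 := h.tendsto (j + 1) hj f
  have h2 := h.tendsto (j + 1) hj (backwardShift θ f)
  have h3 := h.tendsto j hj.le (backwardShift θ f)
  have h0 : Tendsto (fun u : ℂ => u) l (𝓝 w) := h.le_nhds
  refine tendsto_nhds_unique (h1.congr' ?_) ((h0.mul h2).add (h3.const_mul ((j : ℂ) + 1)))
  filter_upwards [h.eventually_disk] with u hu
  exact iteratedDeriv_diskValue_succ θ f j hu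

end RepresentsJet

variable (θ)

/-- The principal filter at `w` allows interior points and boundary points to be treated by the same
statements. -/
lemma representsJet_pure (n : ℕ) {w : ℂ} (hw : ‖w‖ < 1) :
    RepresentsJet θ n w (pure w) fun j => kernelDeriv θ j w where
  le_nhds := pure_le_nhds w
  eventually_disk := hw
  tendsto j _ f := by
    rw [inner_kernelDeriv θ j hw]
    exact tendsto_pure_nhds _ _

/-- The radial sequence lies in the Stolz angle of aperture `2`, since there `‖ζ - w‖ = 1 - ‖w‖ >
0`. -/
lemma tendsto_nontangential {ζ : ℂ} (hζ : ‖ζ‖ = 1) :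
    Tendsto (fun m : ℕ => ((1 - 1 / ((m : ℝ) + 1) : ℝ) : ℂ) * ζ) atTop (nontangential ζ) := by
  refine Tendsto.mono_right (y := 𝓝[stolzAngle 2 ζ] ζ) ?_ (le_iSup (fun M => 𝓝[stolzAngle M ζ] ζ) 2)
  refine tendsto_nhdsWithin_iff.mpr ⟨?_, Eventually.of_forall fun m => ?_⟩
  · have h1 : Tendsto (fun m : ℕ => (1 - 1 / ((m : ℝ) + 1) : ℝ)) atTop (𝓝 (1 - 0)) :=
      tendsto_const_nhds.sub tendsto_one_div_add_atTop_nhds_zero_nat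
    have h2 := ((Complex.continuous_ofReal.tendsto _).comp h1).mul_const ζ
    simpa using h2
  · have hpos : (0 : ℝ) < 1 / ((m : ℝ) + 1) := by positivity
    have hle : 1 / ((m : ℝ) + 1) ≤ 1 := by
      rw [div_le_one (by positivity)]
      linarith [(Nat.cast_nonneg m : (0 : ℝ) ≤ m)]
    set r := 1 / ((m : ℝ) + 1) with hr
    have hn : ‖((1 - r : ℝ) : ℂ) * ζ‖ = 1 - r := by
      rw [norm_mul, hζ, mul_one, Complex.norm_real, Real.norm_of_nonneg (by linarith)]
    refine ⟨by rw [hn]; linarith, ?_⟩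
    have h3 : ζ - ((1 - r : ℝ) : ℂ) * ζ = (r : ℂ) * ζ := by push_cast; ring
    rw [hn, h3, norm_mul, hζ, Complex.norm_real, Real.norm_of_nonneg hpos.le]
    linarith

lemma nontangential_neBot {ζ : ℂ} (hζ : ‖ζ‖ = 1) : (nontangential ζ).NeBot :=
  (tendsto_nontangential hζ).neBot

lemma nontangential_le_nhds (ζ : ℂ) : nontangential ζ ≤ 𝓝 ζ :=
  iSup_le fun _ => nhdsWithin_le_nhds

lemma eventually_nontangential (ζ : ℂ) : ∀ᶠ u in nontangential ζ, ‖u‖ < 1 := by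
  rw [nontangential, eventually_iSup]
  intro M
  filter_upwards [self_mem_nhdsWithin] with u hu
  exact hu.1

/-- The representing vectors are produced along the radial sequence, where the uniform boundedness
principle applies. They represent the full nontangential limits, which exist by the definition of
`Omega`. -/
lemma exists_representsJet_nontangential {n : ℕ} {ζ : ℂ} (hζ : ζ ∈ Omega θ n) :
    ∃ κ, RepresentsJet θ n ζ (nontangential ζ) κ := by
  obtain ⟨h1, hlim⟩ := hζ
  have hseq := tendsto_nontangential h1
  have hdisk := hseq.eventually (eventually_nontangential ζ)
  set μ : ℕ → ℂ := fun m => ((1 - 1 / ((m : ℝ) + 1) : ℝ) : ℂ) * ζ with hμ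
  have hκ : ∀ j, ∃ κ : modelSpace θ, j ≤ n → ∀ f : modelSpace θ,
      Tendsto (iteratedDeriv j (diskValue (f : L2))) (nontangential ζ) (𝓝 (inner ℂ κ f)) := by
    intro j
    by_cases hj : j ≤ n
    · have hconv : ∀ (f : modelSpace θ) (L : ℂ),
          Tendsto (iteratedDeriv j (diskValue (f : L2))) (nontangential ζ) (𝓝 L) →
          Tendsto (fun m => inner ℂ (kernelDeriv θ j (μ m)) f) atTop (𝓝 L) := by
        intro f L hL
        refine (hL.comp hseq).congr' ?_
        filter_upwards [hdisk] with m hm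
        exact (inner_kernelDeriv θ j hm f).symm
      obtain ⟨κ, hκ⟩ := exists_inner_of_tendsto (y := fun m => kernelDeriv θ j (μ m)) fun f => by
        obtain ⟨L, hL⟩ := hlim f f.2 j hj
        exact ⟨L, hconv f L hL⟩
      refine ⟨κ, fun _ f => ?_⟩
      obtain ⟨L, hL⟩ := hlim f f.2 j hj
      rwa [tendsto_nhds_unique (hκ f) (hconv f L hL)]
    · exact ⟨0, fun h => absurd h hj⟩
  choose κ hκ using hκ
  exact ⟨κ, nontangential_le_nhds ζ, eventually_nontangential ζ, fun j hj => hκ j hj⟩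

end

end TruncatedToeplitz

namespace TruncatedToeplitz

noncomputable section

variable (θ : InnerFunction)

/-! ### The elementary operators in terms of jets -/

/-- The Leibniz combination `∑ (n choose i) a_{n - i} ⊗ b_i`. -/
def leibnizOperator (n : ℕ) (a b : ℕ → modelSpace θ) : modelSpace θ →L[ℂ] modelSpace θ :=
  ∑ i ∈ Finset.range (n + 1), (n.choose i : ℂ) • InnerProductSpace.rankOne ℂ (a (n - i)) (b i)

lemma leibnizOperator_apply (n : ℕ) (a b : ℕ → modelSpace θ) (h : modelSpace θ) :
    leibnizOperator θ n a b h =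
      ∑ i ∈ Finset.range (n + 1), ((n.choose i : ℂ) * inner ℂ (b i) h) • a (n - i) := by
  rw [leibnizOperator, sum_apply]
  refine Finset.sum_congr rfl fun i _ => ?_
  rw [smul_apply, InnerProductSpace.rankOne_apply, smul_smul]

lemma inner_leibnizOperator_apply (n : ℕ) (a b : ℕ → modelSpace θ) (g h : modelSpace θ) :
    inner ℂ g (leibnizOperator θ n a b h) =
      ∑ i ∈ Finset.range (n + 1), (n.choose i : ℂ) * inner ℂ (b i) h * inner ℂ g (a (n - i)) := by
  rw [leibnizOperator_apply, inner_sum]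
  exact Finset.sum_congr rfl fun i _ => modelSpace_inner_smul_right θ _ _ _

lemma inner_conjugation_right (f g : modelSpace θ) :
    inner ℂ g (conjugation θ f) = inner ℂ f (conjugation θ g) := by
  rw [← modelSpace_inner_conj_symm, inner_conjugation_left, modelSpace_inner_conj_symm]

lemma iteratedDeriv_diskValue_mul (n : ℕ) {w : ℂ} (hw : ‖w‖ < 1) (f g : modelSpace θ) :
    iteratedDeriv n (fun u => diskValue (f : L2) u * diskValue (g : L2) u) w =
      ∑ i ∈ Finset.range (n + 1), (n.choose i : ℂ) * iteratedDeriv i (diskValue (f : L2)) w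
        * iteratedDeriv (n - i) (diskValue (g : L2)) w :=
  iteratedDeriv_mul (contDiffAt_diskValue θ f n hw) (contDiffAt_diskValue θ g n hw)

/-- By the reproducing property, the matrix entries of `k_w ⊗ k̃_w` are conjugates of products of
two functions of `K_θ` evaluated at `w`. Leibniz' rule reduces the operator derivative to scalar
jets, whose boundary limits are known. -/
lemma inner_iteratedDeriv_dbar (n : ℕ) {w : ℂ} (hw : ‖w‖ < 1) (g h : modelSpace θ) :
    inner ℂ g (iteratedDeriv n (fun ν => InnerProductSpace.rankOne ℂ (kernel θ (conj ν))
      (conjKernel θ (conj ν))) (conj w) h) =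
      conj (∑ i ∈ Finset.range (n + 1),
        (n.choose i : ℂ) * iteratedDeriv i (diskValue (conjugation θ h : L2)) w
          * iteratedDeriv (n - i) (diskValue (g : L2)) w) := by
  have hw' := norm_conj_lt_one hw
  have h1 : (fun ν => InnerProductSpace.rankOne ℂ (kernel θ (conj ν)) (conjKernel θ (conj ν)))
      =ᶠ[𝓝 (conj w)] fun ν => InnerProductSpace.rankOne ℂ (kernelResolvent θ ν)
        (conjugation θ (kernelResolvent θ ν)) := by
    filter_upwards [disk_mem_nhds hw'] with ν hν
    rw [← conjugation_kernel, kernel_eq_kernelResolvent θ (norm_conj_lt_one hν),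
      Complex.conj_conj]
  have h2 : (fun ν => inner ℂ g (InnerProductSpace.rankOne ℂ (kernelResolvent θ ν)
        (conjugation θ (kernelResolvent θ ν)) h)) =ᶠ[𝓝 (conj w)]
      fun ν => conj ((fun u => diskValue (conjugation θ h : L2) u * diskValue (g : L2) u)
        (conj ν)) := by
    filter_upwards [disk_mem_nhds hw'] with ν hν
    have hν' := norm_conj_lt_one hν
    rw [InnerProductSpace.rankOne_apply, modelSpace_inner_smul_right, inner_conjugation_left,
      map_mul, ← inner_kernel_eq_diskValue θ hν', ← inner_kernel_eq_diskValue θ hν',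
      modelSpace_inner_conj_symm, modelSpace_inner_conj_symm, kernel_eq_kernelResolvent θ hν',
      Complex.conj_conj]
  rw [h1.iteratedDeriv_eq, inner_iteratedDeriv_apply (fun ν hν => differentiableAt_rankOne _
    (differentiableAt_kernelResolvent θ hν)) g h n hw', h2.iteratedDeriv_eq,
    iteratedDeriv_conj_conj (fun u => diskValue (conjugation θ h : L2) u * diskValue (g : L2) u),
    iteratedDeriv_diskValue_mul θ n hw]

lemma inner_iteratedDeriv_d (n : ℕ) {w : ℂ} (hw : ‖w‖ < 1) (g h : modelSpace θ) :
    inner ℂ g (iteratedDeriv n (fun μ => InnerProductSpace.rankOne ℂ (conjKernel θ μ)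
      (kernel θ μ)) w h) =
      ∑ i ∈ Finset.range (n + 1), (n.choose i : ℂ) * iteratedDeriv i (diskValue (h : L2)) w
        * iteratedDeriv (n - i) (diskValue (conjugation θ g : L2)) w := by
  have h1 : (fun μ => InnerProductSpace.rankOne ℂ (conjKernel θ μ) (kernel θ μ))
      =ᶠ[𝓝 w] fun μ => InnerProductSpace.rankOne ℂ (conjugation θ (kernelResolvent θ (conj μ)))
        (conjugation θ (conjugation θ (kernelResolvent θ (conj μ)))) := by
    filter_upwards [disk_mem_nhds hw] with μ hμ
    rw [← conjugation_kernel, kernel_eq_kernelResolvent θ hμ, conjugation_conjugation]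
  have h2 : (fun μ => inner ℂ g (InnerProductSpace.rankOne ℂ
        (conjugation θ (kernelResolvent θ (conj μ)))
        (conjugation θ (conjugation θ (kernelResolvent θ (conj μ)))) h)) =ᶠ[𝓝 w]
      fun u => diskValue (h : L2) u * diskValue (conjugation θ g : L2) u := by
    filter_upwards [disk_mem_nhds hw] with μ hμ
    rw [InnerProductSpace.rankOne_apply, modelSpace_inner_smul_right, conjugation_conjugation,
      inner_conjugation_right, ← kernel_eq_kernelResolvent θ hμ, inner_kernel_eq_diskValue θ hμ,
      inner_kernel_eq_diskValue θ hμ]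
  rw [h1.iteratedDeriv_eq, inner_iteratedDeriv_apply (fun μ hμ => differentiableAt_rankOne _
    (differentiableAt_conj_semilinear _
      (differentiableAt_kernelResolvent θ (norm_conj_lt_one hμ)))) g h n hw,
    h2.iteratedDeriv_eq, iteratedDeriv_diskValue_mul θ n hw]

variable {θ}

lemma RepresentsJet.tendsto_dbar {n : ℕ} {w : ℂ} {l : Filter ℂ} {κ : ℕ → modelSpace θ}
    (hκ : RepresentsJet θ n w l κ) (g h : modelSpace θ) :
    Tendsto (fun u => inner ℂ g (iteratedDeriv n (fun ν => InnerProductSpace.rankOne ℂ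
      (kernel θ (conj ν)) (conjKernel θ (conj ν))) (conj u) h)) l
      (𝓝 (inner ℂ g (leibnizOperator θ n κ (fun i => conjugation θ (κ i)) h))) := by
  have h1 : Tendsto (fun u => conj (∑ i ∈ Finset.range (n + 1),
        (n.choose i : ℂ) * iteratedDeriv i (diskValue (conjugation θ h : L2)) u
          * iteratedDeriv (n - i) (diskValue (g : L2)) u)) l
      (𝓝 (conj (∑ i ∈ Finset.range (n + 1),
        (n.choose i : ℂ) * inner ℂ (κ i) (conjugation θ h) * inner ℂ (κ (n - i)) g))) := by
    refine (Complex.continuous_conj.tendsto _).comp (tendsto_finsetSum _ fun i hi => ?_)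
    rw [Finset.mem_range, Nat.lt_succ_iff] at hi
    exact ((hκ.tendsto i hi _).const_mul _).mul (hκ.tendsto (n - i) (Nat.sub_le n i) g)
  have h2 : inner ℂ g (leibnizOperator θ n κ (fun i => conjugation θ (κ i)) h) =
      conj (∑ i ∈ Finset.range (n + 1),
        (n.choose i : ℂ) * inner ℂ (κ i) (conjugation θ h) * inner ℂ (κ (n - i)) g) := by
    rw [inner_leibnizOperator_apply, map_sum]
    refine Finset.sum_congr rfl fun i _ => ?_
    rw [map_mul, map_mul, modelSpace_inner_conj_symm, modelSpace_inner_conj_symm,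
      inner_conjugation_left, Complex.conj_natCast]
  rw [h2]
  refine h1.congr' ?_
  filter_upwards [hκ.eventually_disk] with u hu
  exact (inner_iteratedDeriv_dbar θ n hu g h).symm

lemma opDbar_eq_of_norm_lt {n : ℕ} {w : ℂ} (hw : ‖w‖ < 1) :
    opDbar θ n w = leibnizOperator θ n (fun j => kernelDeriv θ j w)
      (fun j => conjugation θ (kernelDeriv θ j w)) := by
  rw [opDbar, boundaryExtend, if_pos hw]
  ext1 h
  refine ext_inner_left ℂ fun g => ?_
  exact tendsto_nhds_unique (tendsto_pure_nhds _ _)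
    ((representsJet_pure θ n hw).tendsto_dbar g h)

lemma opDbar_eq_of_mem_Omega {n : ℕ} {ζ : ℂ} (hζ : ‖ζ‖ = 1) {κ : ℕ → modelSpace θ}
    (hκ : RepresentsJet θ n ζ (nontangential ζ) κ) :
    opDbar θ n ζ = leibnizOperator θ n κ (fun j => conjugation θ (κ j)) := by
  have := nontangential_neBot hζ
  rw [opDbar, boundaryExtend, if_neg hζ.not_lt, Tendsto.limUnder_eq
    (x := ContinuousLinearMapWOT.ofCLM (leibnizOperator θ n κ (fun j => conjugation θ (κ j))))]
  exact ContinuousLinearMapWOT.tendsto_iff_forall_inner_apply_tendsto.mpr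
    fun h g => hκ.tendsto_dbar g h

lemma opD_eq_of_norm_lt {n : ℕ} {w : ℂ} (hw : ‖w‖ < 1) :
    opD θ n w = leibnizOperator θ n (fun j => conjugation θ (kernelDeriv θ j w))
      (fun j => kernelDeriv θ j w) := by
  rw [opD, boundaryExtend, if_pos hw]
  ext1 h
  refine ext_inner_left ℂ fun g => ?_
  refine (inner_iteratedDeriv_d θ n hw g h).trans ?_
  rw [inner_leibnizOperator_apply]
  refine Finset.sum_congr rfl fun i _ => ?_
  rw [inner_conjugation_right, inner_kernelDeriv θ i hw, inner_kernelDeriv θ (n - i) hw]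

/-- The range of a Leibniz combination with linearly independent right factors. -/
lemma range_leibnizOperator {n : ℕ} {a b : ℕ → modelSpace θ}
    (hb : ∀ d : ℕ → ℂ, (∀ f, ∑ j ∈ Finset.range (n + 1), d j * inner ℂ (b j) f = 0) →
      ∀ j ≤ n, d j = 0) :
    (leibnizOperator θ n a b).range = Submodule.span ℂ (a '' Set.Iic n) := by
  have hsurj : ∀ c : Fin (n + 1) → ℂ, ∃ h : modelSpace θ,
      ∀ j : Fin (n + 1), inner ℂ (b j) h = c j := by
    set Φ : modelSpace θ →ₗ[ℂ] (Fin (n + 1) → ℂ) :=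
      LinearMap.pi fun j => (innerSL ℂ (b j)).toLinearMap with hΦ
    suffices LinearMap.range Φ = ⊤ by
      intro c
      obtain ⟨h, hh⟩ := LinearMap.range_eq_top.mp this c
      exact ⟨h, fun j => congrFun hh j⟩
    by_contra hne
    -- A functional annihilating the image would be a linear relation between the `b j`, its
    -- coefficients being its values on the standard basis.
    obtain ⟨f, hf0, hf⟩ := Submodule.exists_le_ker_of_lt_top _ (lt_top_iff_ne_top.mpr hne)
    refine hf0 (LinearMap.pi_ext' fun i => LinearMap.ext_ring ?_)
    have h1 := hb (fun j => if hj : j < n + 1 then f (Pi.single ⟨j, hj⟩ 1) else 0) (fun x => by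
      have hx : f (Φ x) = 0 := hf (LinearMap.mem_range_self Φ x)
      rw [← Finset.univ_sum_single (Φ x), map_sum] at hx
      rw [Finset.sum_range, ← hx]
      refine Finset.sum_congr rfl fun i _ => ?_
      rw [dif_pos i.2, mul_comm, ← smul_eq_mul (inner ℂ (b i) x), ← map_smul]
      congr 1
      rw [← Pi.single_smul, smul_eq_mul, mul_one]
      rfl) i (Nat.lt_succ_iff.mp i.2)
    simpa [Nat.lt_succ_iff.mp i.2] using h1
  refine le_antisymm ?_ (Submodule.span_le.mpr ?_)
  · rintro _ ⟨h, rfl⟩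
    change leibnizOperator θ n a b h ∈ _
    rw [leibnizOperator_apply]
    exact Submodule.sum_mem _ fun i _ => Submodule.smul_mem _ _
      (Submodule.subset_span ⟨n - i, Nat.sub_le n i, rfl⟩)
  · rintro _ ⟨j, hj, rfl⟩
    have hj : j ≤ n := hj
    -- The vector `a j` appears only in the term `i = n - j`; prescribing the reciprocal of its
    -- binomial coefficient isolates it.
    obtain ⟨h, hh⟩ := hsurj fun i => if (i : ℕ) = n - j then ((n.choose (n - j) : ℂ))⁻¹ else 0
    refine ⟨h, ?_⟩
    change leibnizOperator θ n a b h = _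
    rw [leibnizOperator_apply, Finset.sum_eq_single (n - j)]
    · have h1 := hh ⟨n - j, by omega⟩
      simp only [if_true] at h1
      have h2 : (n.choose (n - j) : ℂ) ≠ 0 :=
        Nat.cast_ne_zero.mpr (Nat.choose_pos (Nat.sub_le n j)).ne'
      rw [h1, mul_inv_cancel₀ h2, one_smul, Nat.sub_sub_self hj]
    · intro i hi hij
      have h1 := hh ⟨i, Finset.mem_range.mp hi⟩
      simp only [if_neg hij] at h1
      rw [h1, mul_zero, zero_smul]
    · intro h1
      exact absurd (Finset.mem_range.mpr (by omega)) h1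

end

end TruncatedToeplitz

namespace TruncatedToeplitz

noncomputable section

/-! ### Chains of kernels -/

open Polynomial in
/-- The polynomial whose value at the backward shift vanishes at the point of a chain: `z - w`
for a chain of kernels, `1 / z - conj w` for a chain of conjugate kernels, up to powers of `z`. -/
def chainPoly (outer : Bool) (w : ℂ) : ℂ[X] :=
  match outer with
  | false => C (-w) * X + C 1
  | true => C 1 * X + C (-conj w)

open Polynomial in
/-- The shift attached to a chain. -/
def chainShift (outer : Bool) : ℂ[X] :=
  match outer with
  | false => X
  | true => 1

variable (θ : InnerFunction)

/-- The vectors of a chain: kernels for the points of the closed disk, conjugate kernels for the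
points outside of it. -/
def chainVector (outer : Bool) (κ : ℕ → modelSpace θ) (j : ℕ) : modelSpace θ :=
  match outer with
  | false => κ j
  | true => conjugation θ (κ j)

/-- The functionals attached to a chain, on the functions vanishing at the origin. -/
def chainFunctional (outer : Bool) (κ : ℕ → modelSpace θ) (j : ℕ) : modelSpace θ →ₗ[ℂ] ℂ :=
  match outer with
  | false => ((innerSL ℂ (κ j)).comp (backwardShift θ)).toLinearMap
  | true => (innerSL ℂ (conjugation θ (κ j))).toLinearMap

/-- The relations between the derivatives of order at most `n` of the kernel at the point `w`. -/
structure KernelChain (n : ℕ) (w : ℂ) (κ : ℕ → modelSpace θ) : Prop where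
  norm_le : ‖w‖ ≤ 1
  inner_zero : ∀ f, inner ℂ (κ 0) f = w * inner ℂ (κ 0) (backwardShift θ f) + evalZero θ f
  inner_succ : ∀ j < n, ∀ f, inner ℂ (κ (j + 1)) f =
    w * inner ℂ (κ (j + 1)) (backwardShift θ f) + (j + 1) * inner ℂ (κ j) (backwardShift θ f)

lemma RepresentsJet.kernelChain {θ : InnerFunction} {n : ℕ} {w : ℂ} {l : Filter ℂ} [l.NeBot]
    {κ : ℕ → modelSpace θ} (h : RepresentsJet θ n w l κ) (hw : ‖w‖ ≤ 1) : KernelChain θ n w κ :=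
  ⟨hw, h.inner_zero, fun _ hj f => h.inner_succ hj f⟩

/-- The backward shift as an element of the algebra of endomorphisms. -/
abbrev shiftEnd : Module.End ℂ (modelSpace θ) := (backwardShift θ).toLinearMap

/-- Evaluation at the origin as a linear functional. -/
abbrev evalZeroLin : modelSpace θ →ₗ[ℂ] ℂ := (evalZero θ).toLinearMap

lemma shiftEnd_pow_apply (i : ℕ) (f : modelSpace θ) :
    (shiftEnd θ ^ i) f = (backwardShift θ ^ i) f := by
  induction i with
  | zero => rfl
  | succ i ih => rw [pow_succ', pow_succ', Module.End.mul_apply, ih]; rfl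

lemma eq_zero_of_evalZeroLin {f : modelSpace θ}
    (h : ∀ i, evalZeroLin θ ((shiftEnd θ ^ i) f) = 0) : f = 0 := by
  refine eq_zero_of_evalZero_pow θ fun i => ?_
  rw [← shiftEnd_pow_apply]
  exact h i

lemma exists_evalZero_eq_one (hdim : ¬ FiniteDimensional ℂ (modelSpace θ)) :
    ∃ b : modelSpace θ, evalZero θ b = 1 := by
  by_contra! h
  have h0 : ∀ f, evalZero θ f = 0 := by
    intro f
    by_contra hf
    exact h ((evalZero θ f)⁻¹ • f) (by rw [map_smul, smul_eq_mul, inv_mul_cancel₀ hf])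
  refine hdim ?_
  have : Subsingleton (modelSpace θ) := subsingleton_of_forall_eq 0 fun f =>
    eq_zero_of_evalZero_pow θ fun i => h0 _
  infer_instance

/-- If `u` vanishes to order `N`, then `C T ^ N u = z ^ N C u`, and `T ^ i` removes `i` of the
factors `z`. -/
lemma pow_apply_conjugation {N i : ℕ} (hi : i ≤ N) {u : modelSpace θ}
    (hu : u ∈ vanishing (shiftEnd θ) (evalZeroLin θ) N) :
    (shiftEnd θ ^ i) (conjugation θ ((shiftEnd θ ^ N) u)) =
      conjugation θ ((shiftEnd θ ^ (N - i)) u) := by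
  induction i with
  | zero => rfl
  | succ i ih =>
    obtain ⟨m, rfl⟩ : ∃ m, N = m + (i + 1) := ⟨N - (i + 1), by omega⟩
    rw [pow_succ', Module.End.mul_apply, ih (by omega),
      show m + (i + 1) - i = m + 1 by omega, show m + (i + 1) - (i + 1) = m by omega,
      pow_succ' _ m, Module.End.mul_apply]
    exact backwardShift_conjugation_backwardShift θ (hu m (by omega))

lemma conjugation_pow_mem_vanishing {N : ℕ} {u : modelSpace θ}
    (hu : u ∈ vanishing (shiftEnd θ) (evalZeroLin θ) N) :
    conjugation θ ((shiftEnd θ ^ N) u) ∈ vanishing (shiftEnd θ) (evalZeroLin θ) N := by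
  intro i hi
  obtain ⟨m, rfl⟩ : ∃ m, N = m + 1 + i := ⟨N - (i + 1), by omega⟩
  rw [pow_apply_conjugation θ hi.le hu, Nat.add_sub_cancel, pow_succ' _ m, Module.End.mul_apply]
  exact evalZero_conjugation_backwardShift θ (hu m (by omega))

open Polynomial in
lemma natDegree_chainPoly_le (outer : Bool) (w : ℂ) : (chainPoly outer w).natDegree ≤ 1 := by
  cases outer
  · exact natDegree_linear_le
  · exact natDegree_linear_le

open Polynomial in
lemma natDegree_chainShift_le (outer : Bool) : (chainShift outer).natDegree ≤ 1 := by
  cases outer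
  · exact natDegree_X_le
  · simp [chainShift]

open Polynomial in
lemma aeval_linear_apply (a b : ℂ) (f : modelSpace θ) :
    aeval (shiftEnd θ) (C a * X + C b) f = a • backwardShift θ f + b • f := by
  rw [map_add, map_mul, aeval_C, aeval_C, aeval_X, LinearMap.add_apply, Module.End.mul_apply,
    Module.algebraMap_end_apply, Module.algebraMap_end_apply]
  rfl

variable {θ}

namespace KernelChain

variable {n : ℕ} {w : ℂ} {κ : ℕ → modelSpace θ}

lemma inner_zero_of_evalZero (h : KernelChain θ n w κ) {f : modelSpace θ}
    (hf : evalZero θ f = 0) : inner ℂ (κ 0) f = w * inner ℂ (κ 0) (backwardShift θ f) := by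
  rw [h.inner_zero, hf, add_zero]

/-- The relation for `κ 0`, applied to `C T f`, which vanishes at the origin and satisfies `T C T f
= C f`. The conjugation moves the shift to the other side, so that `C κ 0` is an eigenfunctional of
`T` on the kernel of `e`. -/
lemma inner_conjugation_zero (h : KernelChain θ n w κ) {f : modelSpace θ}
    (hf : evalZero θ f = 0) : inner ℂ (conjugation θ (κ 0)) (backwardShift θ f) =
      conj w * inner ℂ (conjugation θ (κ 0)) f := by
  rw [inner_conjugation_left, inner_conjugation_left θ (κ 0) f, ← modelSpace_inner_conj_symm,
    h.inner_zero_of_evalZero (evalZero_conjugation_backwardShift θ hf),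
    backwardShift_conjugation_backwardShift θ hf, map_mul, modelSpace_inner_conj_symm]

lemma inner_conjugation_succ (h : KernelChain θ n w κ) {j : ℕ} (hj : j < n) {f : modelSpace θ}
    (hf : evalZero θ f = 0) : inner ℂ (conjugation θ (κ (j + 1))) (backwardShift θ f) =
      conj w * inner ℂ (conjugation θ (κ (j + 1))) f
        + (j + 1) * inner ℂ (conjugation θ (κ j)) f := by
  rw [inner_conjugation_left, inner_conjugation_left θ (κ (j + 1)) f,
    inner_conjugation_left θ (κ j) f, ← modelSpace_inner_conj_symm, h.inner_succ j hj,
    backwardShift_conjugation_backwardShift θ hf, map_add, map_mul, map_mul,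
    modelSpace_inner_conj_symm, modelSpace_inner_conj_symm]
  simp

lemma zero_ne_zero (h : KernelChain θ n w κ) (hdim : ¬ FiniteDimensional ℂ (modelSpace θ)) :
    κ 0 ≠ 0 := by
  intro h0
  obtain ⟨b, hb⟩ := exists_evalZero_eq_one θ hdim
  have := h.inner_zero b
  simp [h0, hb] at this

/-- The first vector of a chain is determined by its point. -/
lemma zero_unique (h : KernelChain θ n w κ) {n' : ℕ} {κ' : ℕ → modelSpace θ}
    (h' : KernelChain θ n' w κ') : κ 0 = κ' 0 := by
  rw [← sub_eq_zero]
  refine ext_inner_right ℂ fun f => ?_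
  rw [inner_zero_left]
  -- Two solutions of `inner_zero` differ by a vector whose functional satisfies the homogeneous
  -- equation. As `‖w‖ ≤ 1` and `T ^ N f` tends to zero, it vanishes, also at boundary points.
  have hpow : ∀ N : ℕ, inner ℂ (κ 0 - κ' 0) f =
      w ^ N * inner ℂ (κ 0 - κ' 0) ((backwardShift θ ^ N) f) := by
    intro N
    induction N with
    | zero => simp
    | succ N ih =>
      have h1 := h.inner_zero ((backwardShift θ ^ N) f)
      have h2 := h'.inner_zero ((backwardShift θ ^ N) f)
      rw [ih, pow_succ', pow_succ' (backwardShift θ), mul_apply_eq_comp, inner_sub_left,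
        inner_sub_left, h1, h2]
      ring
  have h1 : Tendsto (fun N : ℕ => inner ℂ (κ 0 - κ' 0) ((backwardShift θ ^ N) f)) atTop (𝓝 0) := by
    have h2 := (tendsto_const_nhds (x := κ 0 - κ' 0)).inner (𝕜 := ℂ)
      (tendsto_backwardShift_pow θ f)
    rwa [inner_zero_right] at h2
  refine tendsto_nhds_unique tendsto_const_nhds (squeeze_zero_norm (fun N => ?_)
    (tendsto_zero_iff_norm_tendsto_zero.mp h1))
  rw [hpow N, norm_mul, norm_pow]
  exact mul_le_of_le_one_left (norm_nonneg _) (pow_le_one₀ (norm_nonneg w) h.norm_le)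

lemma exists_inner_conjugation_ne_zero (h : KernelChain θ n w κ)
    (hdim : ¬ FiniteDimensional ℂ (modelSpace θ)) (N : ℕ) :
    ∃ u ∈ vanishing (shiftEnd θ) (evalZeroLin θ) N, inner ℂ (conjugation θ (κ 0)) u ≠ 0 := by
  refine exists_mem_vanishing_ne_zero (l := (innerSL ℂ (conjugation θ (κ 0))).toLinearMap)
    (c := conj w) (fun f => eq_zero_of_evalZeroLin θ) hdim (fun h0 => ?_)
    (fun f hf => h.inner_conjugation_zero hf) N
  have h1 : inner ℂ (conjugation θ (κ 0)) (conjugation θ (κ 0)) = 0 :=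
    LinearMap.congr_fun h0 (conjugation θ (κ 0))
  rw [inner_conjugation_conjugation] at h1
  exact h.zero_ne_zero hdim (inner_self_eq_zero (𝕜 := ℂ).mp h1)

open Polynomial in
-- For conjugate kernels, `T - conj w` plays the part of `z - w`. For kernels it is `1 - w T`, that
-- is `(z - w) / z`, and the superfluous division by `z` is recorded by the shift `X`.
theorem isChain (h : KernelChain θ n w κ) (hdim : ¬ FiniteDimensional ℂ (modelSpace θ))
    (outer : Bool) : IsChain (shiftEnd θ) (evalZeroLin θ) n (chainFunctional θ outer κ)
      (chainPoly outer w) (chainShift outer) where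
  natDegree_le := natDegree_chainPoly_le outer w
  natDegree_le' := natDegree_chainShift_le outer
  apply_zero f hf := by
    cases outer
    · have h1 := h.inner_zero_of_evalZero (eq_zero_of_mem_vanishing_succ (apply_mem_vanishing hf))
      rw [chainPoly, aeval_linear_apply, map_add, map_smul, map_smul]
      change -w * inner ℂ (κ 0) (backwardShift θ (backwardShift θ f))
        + 1 * inner ℂ (κ 0) (backwardShift θ f) = 0
      linear_combination h1
    · have h1 := h.inner_conjugation_zero (eq_zero_of_mem_vanishing_succ hf)
      rw [chainPoly, aeval_linear_apply, map_add, map_smul, map_smul]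
      change 1 * inner ℂ (conjugation θ (κ 0)) (backwardShift θ f)
        + -conj w * inner ℂ (conjugation θ (κ 0)) f = 0
      linear_combination h1
  apply_succ j hj f hf := by
    cases outer
    · have h1 := h.inner_succ j hj (backwardShift θ f)
      rw [chainPoly, aeval_linear_apply, map_add, map_smul, map_smul, chainShift, aeval_X]
      change -w * inner ℂ (κ (j + 1)) (backwardShift θ (backwardShift θ f))
        + 1 * inner ℂ (κ (j + 1)) (backwardShift θ f)
          = (j + 1) * inner ℂ (κ j) (backwardShift θ (backwardShift θ f))
      linear_combination h1
    · have h1 := h.inner_conjugation_succ hj (eq_zero_of_mem_vanishing_succ hf)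
      rw [chainPoly, aeval_linear_apply, map_add, map_smul, map_smul, chainShift, map_one]
      change 1 * inner ℂ (conjugation θ (κ (j + 1))) (backwardShift θ f)
        + -conj w * inner ℂ (conjugation θ (κ (j + 1))) f
          = (j + 1) * inner ℂ (conjugation θ (κ j)) f
      linear_combination h1
  exists_ne_zero N := by
    obtain ⟨u, hu, hne⟩ := h.exists_inner_conjugation_ne_zero hdim (N + 1)
    cases outer
    -- For kernels the eigenvalue relation goes the wrong way, and `w` may be zero. The witness for
    -- the conjugate kernel is carried over as `x = z ^ (N + 1) C u`.
    · obtain ⟨x, hx, hxu⟩ : ∃ x ∈ vanishing (shiftEnd θ) (evalZeroLin θ) (N + 1),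
          (shiftEnd θ ^ (N + 1)) x = conjugation θ u :=
        ⟨_, conjugation_pow_mem_vanishing θ hu, by simpa using pow_apply_conjugation θ le_rfl hu⟩
      refine ⟨x, hx, fun h0 => hne ?_⟩
      rw [chainShift, map_pow, aeval_X] at h0
      rw [pow_succ', Module.End.mul_apply] at hxu
      rw [inner_conjugation_left, ← hxu, ← modelSpace_inner_conj_symm, map_eq_zero]
      exact h0
    · refine ⟨u, hu, ?_⟩
      rw [chainShift, one_pow, map_one]
      exact hne

open Polynomial in
lemma actsNonzero (h : KernelChain θ n w κ) {outer outer' : Bool} {w' : ℂ}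
    (hsame : outer = outer' → w ≠ w') (hdiff : outer ≠ outer' → conj w * w' ≠ 1) :
    ActsNonzero (shiftEnd θ) (evalZeroLin θ) (chainFunctional θ outer κ 0) (chainShift outer) 1
      (chainPoly outer' w') := by
  -- A linear polynomial in `T` acts on the first functional as multiplication by its value at the
  -- point of the chain. The hypotheses say that the root of the other polynomial is elsewhere.
  have key : ∀ a b : ℂ, (match outer with | false => a + b * w | true => a * conj w + b) ≠ 0 →
      ∃ c : ℂ, c ≠ 0 ∧ ∀ f ∈ vanishing (shiftEnd θ) (evalZeroLin θ) (1 + 1),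
        chainFunctional θ outer κ 0 (aeval (shiftEnd θ) (C a * X + C b) f) =
          c * chainFunctional θ outer κ 0 (aeval (shiftEnd θ) (chainShift outer ^ 1) f) := by
    intro a b hab
    refine ⟨_, hab, fun f hf => ?_⟩
    rw [aeval_linear_apply, map_add, map_smul, map_smul, pow_one]
    cases outer
    · have h1 := h.inner_zero_of_evalZero (eq_zero_of_mem_vanishing_succ (apply_mem_vanishing hf))
      rw [chainShift, aeval_X]
      change a * inner ℂ (κ 0) (backwardShift θ (backwardShift θ f))
        + b * inner ℂ (κ 0) (backwardShift θ f)
          = (a + b * w) * inner ℂ (κ 0) (backwardShift θ (backwardShift θ f))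
      linear_combination b * h1
    · have h1 := h.inner_conjugation_zero (eq_zero_of_mem_vanishing_succ hf)
      rw [chainShift, map_one]
      change a * inner ℂ (conjugation θ (κ 0)) (backwardShift θ f)
        + b * inner ℂ (conjugation θ (κ 0)) f
          = (a * conj w + b) * inner ℂ (conjugation θ (κ 0)) f
      linear_combination a * h1
  refine ⟨natDegree_chainPoly_le outer' w', ?_⟩
  cases outer' with
  | false =>
    refine key (-w') 1 ?_
    cases outer with
    | false =>
      intro h0
      exact hsame rfl (by linear_combination h0)
    | true =>
      intro h0
      exact hdiff (by simp) (by linear_combination -h0)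
  | true =>
    refine key 1 (-conj w') ?_
    cases outer with
    | false =>
      intro h0
      refine hdiff (by simp) ?_
      have h1 := congrArg conj h0
      simp only [map_add, map_mul, map_neg, map_one, Complex.conj_conj, map_zero] at h1
      linear_combination -h1
    | true =>
      intro h0
      refine hsame rfl ((starRingEnd ℂ).injective ?_)
      linear_combination h0

/-- The functionals of a single chain are linearly independent on the functions vanishing at the
origin. -/
lemma coeff_eq_zero (h : KernelChain θ n w κ) (hdim : ¬ FiniteDimensional ℂ (modelSpace θ))
    (outer : Bool) {d : ℕ → ℂ}
    (hd : ∀ g, evalZero θ g = 0 →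
      ∑ j ∈ Finset.range (n + 1), d j * chainFunctional θ outer κ j g = 0) :
    ∀ j ≤ n, d j = 0 := fun j hj =>
  IsChain.coeff_eq_zero (ι := Unit) (n := fun _ => n) (d := fun _ => d)
    (fun _ => h.isChain hdim outer) (fun k l hkl => absurd (Subsingleton.elim l k) hkl)
    (fun g hg => by simpa using hd g hg) () hj

lemma range_leibniz (h : KernelChain θ n w κ) (hdim : ¬ FiniteDimensional ℂ (modelSpace θ)) :
    (leibnizOperator θ n κ fun j => conjugation θ (κ j)).range =
      Submodule.span ℂ (chainVector θ false κ '' Set.Iic n) :=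
  range_leibnizOperator fun _ hd => h.coeff_eq_zero hdim true fun g _ => hd g

/-- Here the right factors are the kernels. A relation between them, tested on the vectors `T g`, is
a relation between the functionals of the inner chain. -/
lemma range_leibniz_conjugation (h : KernelChain θ n w κ)
    (hdim : ¬ FiniteDimensional ℂ (modelSpace θ)) :
    (leibnizOperator θ n (fun j => conjugation θ (κ j)) κ).range =
      Submodule.span ℂ (chainVector θ true κ '' Set.Iic n) :=
  range_leibnizOperator fun _ hd => h.coeff_eq_zero hdim false fun g _ => hd (backwardShift θ g)

end KernelChain

/-- The spaces `F(w, n)` are spanned by chains of kernels or of conjugate kernels. -/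
theorem exists_kernelChain (hdim : ¬ FiniteDimensional ℂ (modelSpace θ)) {n : ℕ}
    {x : OnePoint ℂ} (hx : x ∈ admissible θ n) : ∃ (outer : Bool) (w : ℂ) (κ : ℕ → modelSpace θ),
      KernelChain θ n w κ ∧ (outer = true → ‖w‖ < 1) ∧
      rangeSpace θ x n = Submodule.span ℂ (chainVector θ outer κ '' Set.Iic n) := by
  have hin : ∀ u : ℂ, ‖u‖ < 1 → KernelChain θ n u fun j => kernelDeriv θ j u := fun u hu =>
    (representsJet_pure θ n hu).kernelChain hu.le
  rcases hx with ⟨w, (hw | hw) | hw, rfl⟩ | hx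
  · have hw : ‖w‖ < 1 := hw
    refine ⟨false, w, fun j => kernelDeriv θ j w, hin w hw, by simp, ?_⟩
    change (if ‖w‖ ≤ 1 then (opDbar θ n w).range else (opD θ n (1 / conj w)).range) = _
    rw [if_pos hw.le, opDbar_eq_of_norm_lt hw, (hin w hw).range_leibniz hdim]
  · obtain ⟨κ, hκ⟩ := exists_representsJet_nontangential θ hw
    have := nontangential_neBot hw.1
    have hκ' := hκ.kernelChain hw.1.le
    refine ⟨false, w, κ, hκ', by simp, ?_⟩
    change (if ‖w‖ ≤ 1 then (opDbar θ n w).range else (opD θ n (1 / conj w)).range) = _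
    rw [if_pos hw.1.le, opDbar_eq_of_mem_Omega hw.1 hκ, hκ'.range_leibniz hdim]
  · have hw : 1 < ‖w‖ := hw
    have hw' : ‖1 / conj w‖ < 1 := by
      rw [norm_div, norm_one, RCLike.norm_conj]
      exact (div_lt_one (by linarith)).mpr hw
    refine ⟨true, 1 / conj w, fun j => kernelDeriv θ j (1 / conj w), hin _ hw', fun _ => hw', ?_⟩
    change (if ‖w‖ ≤ 1 then (opDbar θ n w).range else (opD θ n (1 / conj w)).range) = _
    rw [if_neg (not_le.mpr hw), opD_eq_of_norm_lt hw', (hin _ hw').range_leibniz_conjugation hdim]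
  · have h0 : ‖(0 : ℂ)‖ < 1 := by simp
    rw [Set.mem_singleton_iff] at hx
    subst hx
    refine ⟨true, 0, fun j => kernelDeriv θ j 0, hin 0 h0, fun _ => h0, ?_⟩
    change (opD θ n 0).range = _
    rw [opD_eq_of_norm_lt h0, (hin 0 h0).range_leibniz_conjugation hdim]

/-! ### Decomposition of an operator along its range -/

/-- The functionals which on the functions vanishing at the origin are combinations of the
functionals of a chain. -/
def chainSpan (n : ℕ) (v : ℕ → modelSpace θ →ₗ[ℂ] ℂ) :
    Submodule ℂ (modelSpace θ →ₗ[ℂ] ℂ) where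
  carrier := {φ | ∃ d : ℕ → ℂ, ∀ g, evalZero θ g = 0 →
    φ g = ∑ j ∈ Finset.range (n + 1), d j * v j g}
  add_mem' := by
    rintro φ φ' ⟨d, hd⟩ ⟨d', hd'⟩
    refine ⟨fun j => d j + d' j, fun g hg => ?_⟩
    rw [LinearMap.add_apply, hd g hg, hd' g hg, ← Finset.sum_add_distrib]
    exact Finset.sum_congr rfl fun j _ => (add_mul _ _ _).symm
  zero_mem' := ⟨0, fun g _ => by simp⟩
  smul_mem' := by
    rintro c φ ⟨d, hd⟩
    refine ⟨fun j => c * d j, fun g hg => ?_⟩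
    rw [LinearMap.smul_apply, hd g hg, smul_eq_mul, Finset.mul_sum]
    exact Finset.sum_congr rfl fun j _ => (mul_assoc _ _ _).symm

lemma mem_chainSpan_of_eq {n : ℕ} {v : ℕ → modelSpace θ →ₗ[ℂ] ℂ} {φ ψ : modelSpace θ →ₗ[ℂ] ℂ}
    (hψ : ψ ∈ chainSpan n v) (h : ∀ g, evalZero θ g = 0 → φ g = ψ g) : φ ∈ chainSpan n v := by
  obtain ⟨d, hd⟩ := hψ
  exact ⟨d, fun g hg => (h g hg).trans (hd g hg)⟩

lemma self_mem_chainSpan {n j : ℕ} (hj : j ≤ n) (v : ℕ → modelSpace θ →ₗ[ℂ] ℂ) :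
    v j ∈ chainSpan n v := by
  refine ⟨Pi.single j 1, fun g _ => ?_⟩
  rw [Finset.sum_eq_single j]
  · simp
  · intro i _ hij
    rw [Pi.single_eq_of_ne hij, zero_mul]
  · intro h
    exact absurd (Finset.mem_range.mpr (Nat.lt_succ_of_le hj)) h

namespace KernelChain

variable {n : ℕ} {w : ℂ} {κ : ℕ → modelSpace θ}

/-- This is why `chainFunctional` composes with `T` only for kernels. On the kernel of `e`, the
relations express `κ j` through the functionals `κ i ∘ T`, but `C κ j ∘ T` through the functionals
`C κ i`. With this choice each span contains both versions of its vectors. -/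
lemma inner_chainVector_mem (h : KernelChain θ n w κ) (outer : Bool) {j : ℕ} (hj : j ≤ n) :
    (innerSL ℂ (chainVector θ outer κ j)).toLinearMap ∈ chainSpan n (chainFunctional θ outer κ) ∧
    ((innerSL ℂ (chainVector θ outer κ j)).comp (backwardShift θ)).toLinearMap ∈
      chainSpan n (chainFunctional θ outer κ) := by
  have hv := self_mem_chainSpan hj (chainFunctional θ outer κ)
  cases outer
  · refine ⟨?_, hv⟩
    cases j with
    | zero =>
      exact mem_chainSpan_of_eq (Submodule.smul_mem _ w hv) fun g hg =>
        h.inner_zero_of_evalZero hg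
    | succ j =>
      exact mem_chainSpan_of_eq (Submodule.add_mem _ (Submodule.smul_mem _ w hv)
        (Submodule.smul_mem _ ((j : ℂ) + 1) (self_mem_chainSpan (Nat.le_of_succ_le hj) _)))
        fun g _ => h.inner_succ j hj g
  · refine ⟨hv, ?_⟩
    cases j with
    | zero =>
      exact mem_chainSpan_of_eq (Submodule.smul_mem _ (conj w) hv) fun g hg =>
        h.inner_conjugation_zero hg
    | succ j =>
      exact mem_chainSpan_of_eq (Submodule.add_mem _ (Submodule.smul_mem _ (conj w) hv)
        (Submodule.smul_mem _ ((j : ℂ) + 1) (self_mem_chainSpan (Nat.le_of_succ_le hj) _)))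
        fun g hg => h.inner_conjugation_succ hj hg

lemma inner_mem_chainSpan (h : KernelChain θ n w κ) (outer : Bool) {x : modelSpace θ}
    (hx : x ∈ Submodule.span ℂ (chainVector θ outer κ '' Set.Iic n)) :
    (innerSL ℂ x).toLinearMap ∈ chainSpan n (chainFunctional θ outer κ) ∧
    ((innerSL ℂ x).comp (backwardShift θ)).toLinearMap ∈
      chainSpan n (chainFunctional θ outer κ) := by
  induction hx using Submodule.span_induction with
  | mem x hx =>
    obtain ⟨j, hj, rfl⟩ := hx
    exact h.inner_chainVector_mem outer hj
  | zero =>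
    exact ⟨mem_chainSpan_of_eq (Submodule.zero_mem _) fun g _ => inner_zero_left g,
      mem_chainSpan_of_eq (Submodule.zero_mem _) fun g _ =>
        inner_zero_left (backwardShift θ g)⟩
  | add x y _ _ hx hy =>
    exact ⟨mem_chainSpan_of_eq (Submodule.add_mem _ hx.1 hy.1) fun g _ => inner_add_left x y g,
      mem_chainSpan_of_eq (Submodule.add_mem _ hx.2 hy.2) fun g _ => inner_add_left x y _⟩
  | smul c x _ hx =>
    exact ⟨mem_chainSpan_of_eq (Submodule.smul_mem _ (conj c) hx.1)
      fun g _ => modelSpace_inner_smul_left θ c x g,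
      mem_chainSpan_of_eq (Submodule.smul_mem _ (conj c) hx.2)
        fun g _ => modelSpace_inner_smul_left θ c x _⟩

end KernelChain

/-- A bounded operator with range a direct sum of finite-dimensional spaces is the sum of
bounded operators whose ranges are these spaces. -/
lemma exists_decomposition {H : Type*} [NormedAddCommGroup H] [NormedSpace ℂ H] {ι : Type*}
    [Fintype ι] (A : H →L[ℂ] H) (F : ι → Submodule ℂ H)
    [∀ k, FiniteDimensional ℂ (F k)] (hindep : iSupIndep F) (hrange : A.range = ⨆ k, F k) :
    ∃ B : ι → H →L[ℂ] H, (∀ k, (B k).range = F k) ∧ A = ∑ k, B k := by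
  classical
  set Φ : (∀ k, F k) →ₗ[ℂ] H := LinearMap.lsum ℂ (fun k => F k) ℂ fun k => (F k).subtype with hΦ
  have hΦapply : ∀ x, Φ x = ∑ k, (x k : H) := fun x => by simp [hΦ]
  have hinj : Function.Injective Φ := by
    rw [← LinearMap.ker_eq_bot, LinearMap.ker_eq_bot']
    intro x hx
    rw [hΦapply] at hx
    ext1 k
    rw [← Finset.add_sum_erase _ _ (Finset.mem_univ k), add_eq_zero_iff_eq_neg] at hx
    refine Subtype.ext (Submodule.disjoint_def.mp (hindep k) _ (x k).2 ?_)
    rw [hx]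
    refine Submodule.neg_mem _ (Submodule.sum_mem _ fun l hl => ?_)
    exact Submodule.mem_iSup_of_mem l
      (Submodule.mem_iSup_of_mem (Finset.ne_of_mem_erase hl) (x l).2)
  have hsingle : ∀ (k : ι) (x : F k), Φ (Pi.single k x) = x := by
    intro k x
    rw [hΦapply, Finset.sum_eq_single k]
    · rw [Pi.single_eq_same]
    · intro l _ hl
      rw [Pi.single_eq_of_ne hl, Submodule.coe_zero]
    · exact fun h => absurd (Finset.mem_univ k) h
  have hmem : ∀ h, A h ∈ LinearMap.range Φ := by
    intro h
    have h1 : A h ∈ ⨆ k, F k := hrange ▸ ⟨h, rfl⟩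
    have h2 : ⨆ k, F k ≤ LinearMap.range Φ :=
      iSup_le fun k x hx => ⟨Pi.single k ⟨x, hx⟩, hsingle k ⟨x, hx⟩⟩
    exact h2 h1
  set e := LinearEquiv.ofInjective Φ hinj with he
  set π : ∀ k, LinearMap.range Φ →ₗ[ℂ] H := fun k =>
    (F k).subtype ∘ₗ LinearMap.proj k ∘ₗ e.symm.toLinearMap with hπ
  have hπapply : ∀ k (x : ∀ k, F k), π k ⟨Φ x, x, rfl⟩ = x k := by
    intro k x
    have h1 : e.symm ⟨Φ x, x, rfl⟩ = x := (LinearEquiv.symm_apply_eq e).mpr rfl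
    change ((e.symm ⟨Φ x, x, rfl⟩ k : F k) : H) = x k
    rw [h1]
  -- The projections of the range are continuous because the range, a finite sum of the `F k`, is
  -- finite-dimensional.
  set B : ι → H →L[ℂ] H := fun k =>
    (LinearMap.toContinuousLinearMap (π k)).comp (A.codRestrict (LinearMap.range Φ) hmem) with hB
  have hBapply : ∀ k h (x : ∀ k, F k), Φ x = A h → B k h = x k := by
    intro k h x hx
    rw [← hπapply k x]
    change π k ⟨A h, hmem h⟩ = _
    congr 1
    exact Subtype.ext hx.symm
  refine ⟨B, fun k => le_antisymm ?_ fun y hy => ?_, ?_⟩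
  · rintro _ ⟨h, rfl⟩
    obtain ⟨x, hx⟩ := hmem h
    change B k h ∈ F k
    rw [hBapply k h x hx]
    exact (x k).2
  · have h1 : y ∈ A.range := by rw [hrange]; exact Submodule.mem_iSup_of_mem k hy
    obtain ⟨h, hh⟩ := h1
    refine ⟨h, ?_⟩
    change B k h = y
    rw [hBapply k h (Pi.single k ⟨y, hy⟩) ((hsingle k ⟨y, hy⟩).trans hh.symm), Pi.single_eq_same]
  · ext1 h
    obtain ⟨x, hx⟩ := hmem h
    rw [sum_apply, ← hx, hΦapply]
    exact Finset.sum_congr rfl fun k _ => (hBapply k h x hx).symm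

/-- The components along a direct sum of chain spaces of a shift invariant operator are shift
invariant. -/
lemma shiftInvariant_of_sum {ι : Type*} [Fintype ι] [DecidableEq ι]
    (hdim : ¬ FiniteDimensional ℂ (modelSpace θ)) {n : ι → ℕ} {outer : ι → Bool} {w : ι → ℂ}
    {κ : ι → ℕ → modelSpace θ} (hκ : ∀ k, KernelChain θ (n k) (w k) (κ k))
    (hcross : ∀ k l, l ≠ k → ActsNonzero (shiftEnd θ) (evalZeroLin θ)
      (chainFunctional θ (outer k) (κ k) 0) (chainShift (outer k)) 1 (chainPoly (outer l) (w l)))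
    {B : ι → modelSpace θ →L[ℂ] modelSpace θ}
    (hB : ∀ k f, B k f ∈ Submodule.span ℂ (chainVector θ (outer k) (κ k) '' Set.Iic (n k)))
    (hsum : ShiftInvariant θ (∑ k, B k)) (k : ι) : ShiftInvariant θ (B k) := by
  intro f g hf hg
  -- The failure of `B k` to be shift invariant at `f` is a functional of `g` built from two vectors
  -- of the chain space, hence a combination of the functionals of that single chain.
  have hmem : ∀ k, ∃ d : ℕ → ℂ, ∀ g, evalZero θ g = 0 →
      inner ℂ (B k f) g - inner ℂ (B k (backwardShift θ f)) (backwardShift θ g) =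
        ∑ j ∈ Finset.range (n k + 1), d j * chainFunctional θ (outer k) (κ k) j g := fun k =>
    Submodule.sub_mem _ ((hκ k).inner_mem_chainSpan (outer k) (hB k f)).1
      ((hκ k).inner_mem_chainSpan (outer k) (hB k (backwardShift θ f))).2
  choose d hd using hmem
  -- Shift invariance of the sum makes the total of these functionals vanish on the kernel of `e`;
  -- independence of the chains then makes each coefficient zero.
  have hzero : ∀ g, evalZero θ g = 0 → ∑ k, ∑ j ∈ Finset.range (n k + 1),
      d k j * chainFunctional θ (outer k) (κ k) j g = 0 := by
    intro g hg
    have h1 := congrArg conj (hsum f g hf hg)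
    rw [modelSpace_inner_conj_symm, modelSpace_inner_conj_symm, sum_apply, sum_apply, sum_inner,
      sum_inner, ← sub_eq_zero, ← Finset.sum_sub_distrib] at h1
    rw [← h1]
    exact Finset.sum_congr rfl fun k _ => (hd k g hg).symm
  have h2 := hd k g hg
  rw [Finset.sum_eq_zero fun j hj => by
    rw [IsChain.coeff_eq_zero (fun k => (hκ k).isChain hdim (outer k)) hcross hzero k
      (Nat.lt_succ_iff.mp (Finset.mem_range.mp hj)), zero_mul], sub_eq_zero] at h2
  have h3 := congrArg conj h2
  rwa [modelSpace_inner_conj_symm, modelSpace_inner_conj_symm] at h3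

lemma chainVector_zero_ne_zero {n : ℕ} {w : ℂ} {κ : ℕ → modelSpace θ} (h : KernelChain θ n w κ)
    (hdim : ¬ FiniteDimensional ℂ (modelSpace θ)) (outer : Bool) :
    chainVector θ outer κ 0 ≠ 0 := by
  cases outer
  · exact h.zero_ne_zero hdim
  · intro h0
    apply h.zero_ne_zero hdim
    rw [← conjugation_conjugation θ (κ 0)]
    change conjugation θ (chainVector θ true κ 0) = 0
    rw [h0, map_zero]

end

end TruncatedToeplitz

/-! ### Assembly of the proof -/

open TruncatedToeplitz in
theorem mainTheorem3 (θ : TruncatedToeplitz.InnerFunction)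
    (hdim : ¬ FiniteDimensional ℂ (TruncatedToeplitz.modelSpace θ))
    (A : TruncatedToeplitz.modelSpace θ →L[ℂ] TruncatedToeplitz.modelSpace θ)
    (hA : TruncatedToeplitz.IsTruncatedToeplitz θ A)
    (s : ℕ) (lam : Fin s → OnePoint ℂ) (n : Fin s → ℕ)
    (hlam : ∀ k, lam k ∈ TruncatedToeplitz.admissible θ (n k))
    (hindep : iSupIndep fun k => TruncatedToeplitz.rangeSpace θ (lam k) (n k))
    (hrange : A.range = ⨆ k, TruncatedToeplitz.rangeSpace θ (lam k) (n k)) :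
    ∃ B : Fin s → (TruncatedToeplitz.modelSpace θ →L[ℂ] TruncatedToeplitz.modelSpace θ),
      (∀ k, TruncatedToeplitz.IsTruncatedToeplitz θ (B k)) ∧
      (∀ k, (B k).range = TruncatedToeplitz.rangeSpace θ (lam k) (n k)) ∧
      A = ∑ k, B k := by
  choose outer w κ hκ hw hspan using fun k => exists_kernelChain hdim (hlam k)
  have hfin : ∀ k, FiniteDimensional ℂ (rangeSpace θ (lam k) (n k)) := fun k => by
    rw [hspan k]
    exact FiniteDimensional.span_of_finite ℂ ((Set.finite_Iic (n k)).image _)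
  obtain ⟨B, hB, hsum⟩ := exists_decomposition A _ hindep hrange
  -- Chains of the same kind at the same point would have the same nonzero first vector, which would
  -- lie in two independent summands.
  have hdistinct : ∀ k l, l ≠ k → outer k = outer l → w k ≠ w l := by
    intro k l hkl ho hwkl
    have hmem : ∀ m, chainVector θ (outer m) (κ m) 0 ∈ rangeSpace θ (lam m) (n m) := fun m => by
      rw [hspan m]
      exact Submodule.subset_span ⟨0, Nat.zero_le _, rfl⟩
    have heq : chainVector θ (outer k) (κ k) 0 = chainVector θ (outer l) (κ l) 0 := by
      have h0 : κ k 0 = κ l 0 := (hκ k).zero_unique (hwkl ▸ hκ l)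
      rw [ho]
      cases outer l
      · exact h0
      · exact congrArg (conjugation θ) h0
    exact chainVector_zero_ne_zero (hκ k) hdim (outer k) (Submodule.disjoint_def.mp
      (hindep.pairwiseDisjoint hkl.symm) _ (hmem k) (heq ▸ hmem l))
  -- Of two chains of different kinds one is outer, so its point is in the open disk, while the
  -- other point is in the closed disk: the product has modulus less than one.
  have hprod : ∀ k l, outer k ≠ outer l → conj (w k) * w l ≠ 1 := by
    intro k l ho h1
    have h2 : ‖w k‖ * ‖w l‖ = 1 := by
      rw [← RCLike.norm_conj (w k), ← norm_mul, h1, norm_one]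
    have h3 := (hκ k).norm_le
    have h4 := (hκ l).norm_le
    rcases Bool.eq_false_or_eq_true (outer k) with hk | hk
    · have h5 := hw k hk
      nlinarith [norm_nonneg (w k), norm_nonneg (w l)]
    · have h5 := hw l (by rw [hk] at ho; simpa using ho.symm)
      nlinarith [norm_nonneg (w k), norm_nonneg (w l)]
  obtain ⟨b, hb⟩ := exists_evalZero_eq_one θ hdim
  refine ⟨B, fun k => ?_, hB, hsum⟩
  refine ShiftInvariant.isTruncatedToeplitz (shiftInvariant_of_sum hdim (outer := outer) hκ
    (fun k l hkl => (hκ k).actsNonzero (hdistinct k l hkl) (hprod k l)) (fun k f => ?_)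
    (hsum ▸ hA.shiftInvariant) k) hb
  rw [← hspan k, ← hB k]
  exact ⟨f, rfl⟩
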